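/- Let $\mathcal T_n$ denote the infinite tree all of whose vertices have $n+1$ neighbours, and consider the nearest-neighbour ferromagnetic Ising model with zero field on it: the energy of $\sigma\in\{\pm1\}^V$ in a finite $\Lambda\subset V$ is $-\sum \sigma(x)\sigma(y)$ over all bonds with at least one end in $\Lambda$. A configuration is a \emph{ground state} if no change at finitely many sites lowers the energy. It is \emph{stable} if there are Gibbs (DLR) states $\langle\cdot\rangle_\beta$, defined for all sufficiently large inverse temperatures $\beta$, that converge weakly to the point mass at it as $\beta\to\infty$. A \emph{$k$-chain} is a sequence $x_0,\dots,x_k$ of distinct, consecutively adjacent vertices. A \emph{covering} by $k$-chains is a collection of $k$-chains such that every vertex belongs to precisely one of them. A covering is \emph{rooted} at a vertex $o$ if its chains can be oriented so that $\mathrm{dist}(o,x_i)=\mathrm{dist}(o,x_0)+i$ for each of them and all $i$. For a set $D$ of bonds, $\sigma_D$ denotes any configuration such that, for adjacent $z,z'$, $\sigma_D(z)\sigma_D(z')=-1$ if $(z,z')\in D$ and $+1$ otherwise; it exists and is unique up to a global spin flip. For odd $k=2m+1$, the set of middle bonds $(x_m,x_{m+1})$ of the chains of a covering is the associated \emph{$k$-covering}.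 1. On $\mathcal T_2$ there is, for every vertex $o$ and every $k\ge 0$, a covering by $k$-chains rooted at $o$. 2. Let $k=2m+1\ge5$ and let $D$ be the $k$-covering associated with a rooted covering of $\mathcal T_2$ by $k$-chains. Then $\sigma_D$ is a ground state and is stable. 3. For $k=1$ this fails on $\mathcal T_2$: if $D$ is the $1$-covering associated with any covering of $\mathcal T_2$ by $1$-chains, then $\sigma_D$ is not a ground state and is not stable. On $\mathcal T_n$ with $n\ge4$, on the other hand, $\sigma_D$ is a stable ground state for every odd $k\ge1$ and the $k$-covering $D$ associated with any covering by $k$-chains. 4. There is $n_0$ such that the following holds for all $l>n\ge n_0$, $n>0$, and every rooted covering $R$ of $\mathcal T_2$ by $k$-chains, $k=l+n-1$. Given a reference configuration $\rho\in\{\pm1\}^V$, call $x_0$ the $(+)$-end of the chain $x_0,\dots,x_k$ of $R$ (oriented away from the root) if $\rho(x_0)=+1$, and call $x_k$ its $(+)$-end otherwise. Let $D_{l:n}(\rho)$ consist of the bonds, one of each chain, that leave $l$ vertices of the chain on the side of its $(+)$-end and $n$ on the other side. (a) For every $\rho$ (in particular for $\rho=\sigma_D$, with $D$ the set of middle bonds,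 when $k$ is odd), every configuration $\sigma_{D_{l:n}(\rho)}$ is a stable ground state. (b) There are configurations $\sigma$ with $\sigma=\sigma_{D_{l:n}(\sigma)}$, i.e. whose $(+)$-ends are read off from $\sigma$ itself (so each chain carries $l$ plus spins and $n$ minus spins). Every such $\sigma$ has a non-zero mean magnetization: the averages of $\sigma$ over the balls of radius $r$ about a vertex converge, as $r\to\infty$, to a non-zero number that does not depend on the vertex. -/

import Mathlib

open MeasureTheory Filter Topology

noncomputable section

namespace CayleyIsing

variable {V : Type*}

/-! ### The Ising model on a locally finite graph -/

/-- The spin space `{+1, -1}`. -/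
abbrev Spin : Type := ℤˣ

/-- Every set of spins is measurable (the spin space is finite and discrete). -/
instance : BorelSpace Spin where
  measurable_eq := by
    have h1 : borel Spin = ⊤ := by
      refine top_unique fun s _ => ?_
      exact MeasurableSpace.measurableSet_generateFrom (isOpen_discrete s)
    rw [h1]
    refine top_unique fun s _ => ?_
    exact ⟨Units.val '' s, trivial, Set.preimage_image_eq s Units.val_injective⟩

/-- The real value `±1` of a spin. -/
def spinVal (s : Spin) : ℝ := ((s : ℤ) : ℝ)

/-- The product `σ(x) σ(y)` over the bond `s(x, y)`. -/
def bondProd (σ : V → Spin) : Sym2 V → ℝ :=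
  Sym2.lift ⟨fun x y => spinVal (σ x) * spinVal (σ y), fun _ _ => mul_comm _ _⟩

/-- The energy of `σ` in the finite box `Λ`: minus the sum of `σ(x) σ(y)` over all the bonds
that have at least one end in `Λ` (nearest neighbour ferromagnet, zero external field). -/
def energy [DecidableEq V] (G : SimpleGraph V) [G.LocallyFinite] (Λ : Finset V)
    (σ : V → Spin) : ℝ :=
  -∑ e ∈ Λ.biUnion (fun x => G.incidenceFinset x), bondProd σ e

/-- The configuration equal to `τ` in `Λ` and to the boundary condition `η` outside `Λ`. -/
def glue [DecidableEq V] (Λ : Finset V) (τ : Λ → Spin) (η : V → Spin) : V → Spin :=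
  fun x => if h : x ∈ Λ then τ ⟨x, h⟩ else η x

/-- The partition function in `Λ` at inverse temperature `β` with boundary condition `η`. -/
def partitionFn [DecidableEq V] (G : SimpleGraph V) [G.LocallyFinite] (β : ℝ) (Λ : Finset V)
    (η : V → Spin) : ℝ :=
  ∑ τ : Λ → Spin, Real.exp (-β * energy G Λ (glue Λ τ η))

/-- The finite volume Gibbs distribution in `Λ` with boundary condition `η`, as a measure on
configurations of the whole graph. -/
def gibbsKernel [DecidableEq V] (G : SimpleGraph V) [G.LocallyFinite] (β : ℝ) (Λ : Finset V)
    (η : V → Spin) : Measure (V → Spin) :=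
  ∑ τ : Λ → Spin,
    ENNReal.ofReal (Real.exp (-β * energy G Λ (glue Λ τ η)) / partitionFn G β Λ η) •
      Measure.dirac (glue Λ τ η)

/-- Ising Gibbs states at inverse temperature `β`: the probability measures that satisfy the
Dobrushin-Lanford-Ruelle equations. -/
def IsGibbsState [DecidableEq V] (G : SimpleGraph V) [G.LocallyFinite] (β : ℝ)
    (μ : ProbabilityMeasure (V → Spin)) : Prop :=
  ∀ (Λ : Finset V) (A : Set (V → Spin)), MeasurableSet A →
    ∫⁻ η, gibbsKernel G β Λ η A ∂(μ : Measure (V → Spin)) = (μ : Measure (V → Spin)) A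

/-- Ground state configurations: no change in a finite set of sites lowers the energy. -/
def IsGroundState [DecidableEq V] (G : SimpleGraph V) [G.LocallyFinite]
    (σ : V → Spin) : Prop :=
  ∀ (Λ : Finset V) (τ : V → Spin), (∀ x ∉ Λ, τ x = σ x) → energy G Λ σ ≤ energy G Λ τ

/-- Stability of a configuration: there are Gibbs states `μ β` for all large `β`, converging
weakly to (the point mass at) `σ` as `β → ∞`. -/
def IsStable [Countable V] [DecidableEq V] (G : SimpleGraph V) [G.LocallyFinite]
    (σ : V → Spin) : Prop :=
  ∃ (β₀ : ℝ) (μ : ℝ → ProbabilityMeasure (V → Spin)),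
    (∀ β ≥ β₀, IsGibbsState G β (μ β)) ∧ Tendsto μ atTop (𝓝 (diracProba σ))

/-- `M` is the mean magnetization of `σ`: the limit of the averages of `σ` over the balls around
any vertex, as the radius tends to infinity. -/
def HasMeanMagnetization (G : SimpleGraph V) (σ : V → Spin) (M : ℝ) : Prop :=
  ∀ v : V, Tendsto
    (fun r : ℕ => (∑ᶠ x ∈ {x : V | G.dist v x ≤ r}, spinVal (σ x)) /
      (({x : V | G.dist v x ≤ r}.ncard : ℕ) : ℝ)) atTop (𝓝 M)

/-! ### Chains, coverings and dimers -/

/-- A `k`-chain: a sequence `x₀, …, x_k` of distinct vertices, consecutive ones being adjacent. -/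
structure IsKChain (G : SimpleGraph V) {k : ℕ} (c : Fin (k + 1) → V) : Prop where
  injective : Function.Injective c
  adj : ∀ j : Fin k, G.Adj (c j.castSucc) (c j.succ)

/-- A covering by `k`-chains: every vertex belongs to precisely one chain of `R`. (Hence `R`
contains each of its chains in one of its two orientations only.) -/
structure IsCovering (G : SimpleGraph V) {k : ℕ} (R : Set (Fin (k + 1) → V)) : Prop where
  chain : ∀ c ∈ R, IsKChain G c
  existsUnique : ∀ x : V, ∃! c, c ∈ R ∧ x ∈ Set.range c

/-- A covering by `k`-chains all of which go away from the root `o`: each step along a chain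
increases the distance from `o` by one. -/
structure IsRootedCovering (G : SimpleGraph V) (o : V) {k : ℕ}
    (R : Set (Fin (k + 1) → V)) : Prop extends IsCovering G R where
  away : ∀ c ∈ R, ∀ i, G.dist o (c i) = G.dist o (c 0) + (i : ℕ)

/-- The bond `(x_j, x_{j+1})` of the chain `x₀, …, x_k`. -/
def chainBond {k : ℕ} (c : Fin (k + 1) → V) (j : Fin k) : Sym2 V :=
  s(c j.castSucc, c j.succ)

/-- The middle dimers of the chains of `R`; meant for `k = 2m + 1`, where the middle dimer is
`(x_m, x_{m+1})`. -/
def middleDimers {k : ℕ} (R : Set (Fin (k + 1) → V)) : Set (Sym2 V) :=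
  {e | ∃ c ∈ R, ∃ j : Fin k, 2 * (j : ℕ) + 1 = k ∧ e = chainBond c j}

/-- The collection `D_{l:n}`, for `k + 1 = l + n`, when the `(+)`-end of each chain is read off
from the spins of `ρ`: the `(+)`-end of the chain `x₀, …, x_k` is `x₀` if `ρ(x₀) = +1`, and `x_k`
otherwise. From each chain the bond is taken that splits its vertices into `l` vertices on the
side of the `(+)`-end and `n` vertices on the side of the other end. -/
def splitDimers {k : ℕ} (R : Set (Fin (k + 1) → V)) (l n : ℕ) (ρ : V → Spin) : Set (Sym2 V) :=
  {e | ∃ c ∈ R, ∃ j : Fin k,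
    (j : ℕ) + 1 = (if ρ (c 0) = 1 then l else n) ∧ e = chainBond c j}

/-- `σ` is one of the configurations `σ_D`: neighbouring spins differ exactly across the bonds
in `D`. -/
def IsDimerConfig (G : SimpleGraph V) (D : Set (Sym2 V)) (σ : V → Spin) : Prop :=
  ∀ z z' : V, G.Adj z z' →
    (s(z, z') ∈ D → σ z * σ z' = -1) ∧ (s(z, z') ∉ D → σ z * σ z' = 1)

end CayleyIsing

end

namespace CayleyIsing

variable {V : Type*}

/-! ### Rooted trees -/

section Tree

variable {G : SimpleGraph V}

/-! Stability is a Peierls argument. Suppose that reversing `σ` in any finite connected set `A`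
costs energy at least proportional to `|A|` (`PeierlsCondition`). Then, in every box with boundary
condition `σ`, a given spin differs from `σ` with probability at most a constant times `exp (-2βκ)`,
uniformly in the box and the site (`gibbsPM_compl_le`). By compactness the finite volume
distributions have a cluster point, which is a Gibbs state with the same bound; letting `β → ∞`
gives the point mass at `σ`. A stable configuration is always a ground state
(`IsStable.isGroundState`), so both positive claims reduce to the Peierls condition.

That condition is a count. In a `d`-regular tree a finite non-empty `A` has at least `(d-2)|A| + 2`
boundary bonds, and the cost of reversing `A` is, up to a factor 2, the number of boundary bonds
minus twice the number of dimers among them. Dimers form a matching, so at most `|A|` of them are on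
the boundary; this suffices for `d ≥ 5`. For `d = 3` one needs at most `(|A| + 2)/3` boundary
dimers, which holds for rooted coverings whose dimers are preceded by at least three vertices of
their chain (`IsRootedCovering.card_dimers_le`). For `k = 1` a path of three vertices whose two
bonds are not dimers has five boundary bonds, at least three of them dimers, so reversing it lowers
the energy.

For the magnetization, the averages over the descendants of a vertex obey the backward equation of a
finite Markov chain, whose state is the first spin of the current chain and the position in it.
Doeblin's condition gives convergence to a limit independent of the starting state, and an explicit
invariant functional shows that the limit is non-zero when `l > n` (`exists_tendsto_meanSpin`). The
limit passes from branches to spheres about any vertex, and then to balls by a Cesàro argument. -/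

/-- Geodesics to `y` and to `z`, prolonged to `x`, are paths from `o` to `x`; they coincide in a
tree, and so do their penultimate vertices. -/
theorem eq_of_adj_of_closer (hG : G.IsTree) {o x y z : V} (hy : G.Adj x y) (hz : G.Adj x z)
    (hdy : G.dist o x = G.dist o y + 1) (hdz : G.dist o x = G.dist o z + 1) : y = z := by
  classical
  have key : ∀ w, G.Adj x w → G.dist o x = G.dist o w + 1 →
      ∃ p : G.Walk o x, p.IsPath ∧ p.penultimate = w := by
    intro w hw hd
    obtain ⟨p, hp⟩ := hG.connected.exists_walk_length_eq_dist o w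
    exact ⟨p.concat hw.symm, SimpleGraph.Walk.isPath_of_length_eq_dist _ (by simp [hp, hd]),
      by simp⟩
  obtain ⟨p, hp, rfl⟩ := key y hy hdy
  obtain ⟨q, hq, rfl⟩ := key z hz hdz
  have := (hG.existsUnique_path o x).unique hp hq
  rw [this]

theorem exists_adj_closer (hG : G.IsTree) {o x : V} (hx : x ≠ o) :
    ∃ y, G.Adj x y ∧ G.dist o x = G.dist o y + 1 := by
  obtain ⟨p, hp⟩ := hG.connected.exists_walk_length_eq_dist x o
  cases p with
  | nil => exact absurd rfl hx
  | cons h q =>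
    rename_i y
    refine ⟨y, h, ?_⟩
    have h1 := SimpleGraph.dist_le q
    simp only [SimpleGraph.Walk.length_cons] at hp
    rw [SimpleGraph.dist_comm] at hp h1
    rcases hG.dist_eq_dist_add_one_of_adj o h with h2 | h2 <;> omega

open Classical in
/-- The neighbour of `x` that is closer to the root `o` (and `x` itself if there is none). -/
noncomputable def parent (G : SimpleGraph V) (o x : V) : V :=
  if h : ∃ y, G.Adj x y ∧ G.dist o x = G.dist o y + 1 then h.choose else x

theorem parent_adj (hG : G.IsTree) {o x : V} (hx : x ≠ o) : G.Adj x (parent G o x) := by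
  have h := exists_adj_closer hG hx
  rw [parent, dif_pos h]
  exact h.choose_spec.1

theorem dist_parent (hG : G.IsTree) {o x : V} (hx : x ≠ o) :
    G.dist o x = G.dist o (parent G o x) + 1 := by
  have h := exists_adj_closer hG hx
  rw [parent, dif_pos h]
  exact h.choose_spec.2

theorem ne_root_of_dist {o x : V} {r : ℕ} (h : G.dist o x = r + 1) : x ≠ o := by
  rintro rfl
  simp at h

theorem eq_parent (hG : G.IsTree) {o x y : V} (h : G.Adj x y)
    (hd : G.dist o x = G.dist o y + 1) : y = parent G o x :=
  have hx := ne_root_of_dist hd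
  eq_of_adj_of_closer hG h (parent_adj hG hx) hd (dist_parent hG hx)

theorem parent_cases (hG : G.IsTree) (o : V) {x y : V} (h : G.Adj x y) :
    (x ≠ o ∧ y = parent G o x) ∨ (y ≠ o ∧ x = parent G o y) := by
  rcases hG.dist_eq_dist_add_one_of_adj o h with h1 | h1
  · exact Or.inl ⟨ne_root_of_dist h1, eq_parent hG h h1⟩
  · exact Or.inr ⟨ne_root_of_dist h1, eq_parent hG h.symm h1⟩

/-! ### Configurations with prescribed, possibly self-consistent, dimers -/

open Classical in
/-- Successive approximations, by distance from the root, of a configuration with dimers `D`. -/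
noncomputable def dimerApprox (G : SimpleGraph V) (o : V) (D : (V → Spin) → Set (Sym2 V)) :
    ℕ → V → Spin
  | 0 => fun _ => 1
  | r + 1 => fun x =>
    if G.dist o x = r + 1 then
      dimerApprox G o D r (parent G o x) *
        (if s(parent G o x, x) ∈ D (dimerApprox G o D r) then -1 else 1)
    else dimerApprox G o D r x

theorem dimerApprox_of_le (o : V) (D : (V → Spin) → Set (Sym2 V)) {r : ℕ} {x : V}
    (h : G.dist o x ≤ r) : dimerApprox G o D r x = dimerApprox G o D (G.dist o x) x := by
  induction r with
  | zero => rw [Nat.le_zero.1 h]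
  | succ r ih =>
    rcases h.lt_or_eq with h1 | h1
    · rw [dimerApprox]
      beta_reduce
      rw [if_neg h1.ne, ih (by omega)]
    · rw [h1]

/-- If membership of the bond from `x` towards the root in `D σ` only depends on `σ` strictly
closer to the root, then there is a configuration `σ` whose dimers are `D σ`. -/
theorem exists_isDimerConfig (hG : G.IsTree) (o : V) (D : (V → Spin) → Set (Sym2 V))
    (hD : ∀ σ τ x, x ≠ o → (∀ y, G.dist o y < G.dist o x → σ y = τ y) →
      s(parent G o x, x) ∈ D σ → s(parent G o x, x) ∈ D τ) :
    ∃ σ, IsDimerConfig G (D σ) σ := by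
  classical
  -- The diagonal of the approximations: stage `r` only alters vertices at distance exactly `r`, so
  -- the value at `x` is final from stage `dist o x` on.
  let σ : V → Spin := fun x => dimerApprox G o D (G.dist o x) x
  have key : ∀ x, x ≠ o →
      σ x = σ (parent G o x) * (if s(parent G o x, x) ∈ D σ then -1 else 1) := by
    intro x hx
    have hd := dist_parent hG hx
    have h1 : σ x = dimerApprox G o D (G.dist o (parent G o x) + 1) x := by
      rw [← hd]
    rw [h1, dimerApprox]
    beta_reduce
    rw [if_pos hd]
    have h2 : ∀ y, G.dist o y < G.dist o x →
        dimerApprox G o D (G.dist o (parent G o x)) y = σ y :=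
      fun y hy => dimerApprox_of_le o D (by omega)
    rw [h2 _ (by omega)]
    -- The hypothesis on `D` is an implication for arbitrary pairs of configurations; used in both
    -- orders it gives the equivalence.
    congr 1
    exact if_congr ⟨hD _ _ x hx h2, hD _ _ x hx fun y hy => (h2 y hy).symm⟩ rfl rfl
  have key2 : ∀ x, x ≠ o → (s(parent G o x, x) ∈ D σ → σ (parent G o x) * σ x = -1) ∧
      (s(parent G o x, x) ∉ D σ → σ (parent G o x) * σ x = 1) := by
    intro x hx
    rw [key x hx]
    constructor
    · intro h
      rw [if_pos h, ← mul_assoc, Int.units_mul_self, one_mul]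
    · intro h
      rw [if_neg h, ← mul_assoc, Int.units_mul_self, one_mul]
  refine ⟨σ, fun z w h => ?_⟩
  rcases parent_cases hG o h with ⟨h1, h2⟩ | ⟨h1, h2⟩
  · rw [Sym2.eq_swap, mul_comm, h2]
    exact key2 z h1
  · rw [h2]
    exact key2 w h1

theorem exists_isDimerConfig_const (hG : G.IsTree) (D : Set (Sym2 V)) :
    ∃ σ, IsDimerConfig G D σ := by
  obtain ⟨o⟩ := hG.connected.nonempty
  exact exists_isDimerConfig hG o (fun _ => D) fun _ _ _ _ _ h => h

/-! ### Finite sets of vertices of a tree -/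

/-- In a finite set of vertices of a tree there are fewer inner bonds than vertices. -/
theorem sum_card_inter_neighbors_le [DecidableEq V] [G.LocallyFinite] (hG : G.IsTree)
    {A : Finset V} (hA : A.Nonempty) :
    ∑ x ∈ A, (G.neighborFinset x ∩ A).card + 2 ≤ 2 * A.card := by
  classical
  obtain ⟨o⟩ := hG.connected.nonempty
  obtain ⟨t, htA, ht⟩ := A.exists_min_image (fun x => G.dist o x) hA
  let r : V → V → Prop := fun x y => G.Adj x y ∧ G.dist o x = G.dist o y + 1
  have h1 : ∀ x ∈ A, (G.neighborFinset x ∩ A).card ≤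
      (A.bipartiteAbove r x).card + (A.bipartiteBelow r x).card := by
    intro x _
    refine (Finset.card_le_card fun y hy => ?_).trans (Finset.card_union_le _ _)
    simp only [Finset.mem_inter, SimpleGraph.mem_neighborFinset] at hy
    simp only [Finset.mem_union, Finset.mem_bipartiteAbove, Finset.mem_bipartiteBelow]
    rcases hG.dist_eq_dist_add_one_of_adj o hy.1 with h | h
    · exact Or.inl ⟨hy.2, hy.1, h⟩
    · exact Or.inr ⟨hy.2, hy.1.symm, h⟩
  have h2 := Finset.sum_card_bipartiteAbove_eq_sum_card_bipartiteBelow (s := A) (t := A) r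
  -- Each inner bond is charged to its end farther from the root. Every vertex has at most one
  -- closer neighbour, and the vertex `t` closest to the root has none in `A`, so there are at most
  -- `|A| - 1` inner bonds.
  have h3 : ∑ x ∈ A, (A.bipartiteAbove r x).card ≤ ∑ x ∈ A, if x = t then 0 else 1 := by
    refine Finset.sum_le_sum fun x hx => ?_
    split_ifs with hxt
    · refine le_of_eq (Finset.card_eq_zero.2 (Finset.eq_empty_of_forall_notMem fun y hy => ?_))
      obtain ⟨hyA, -, hd⟩ := (Finset.mem_bipartiteAbove r).1 hy
      have := ht y hyA
      subst hxt
      omega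
    · refine Finset.card_le_one.2 fun y hy z hz => ?_
      obtain ⟨-, hy1, hy2⟩ := (Finset.mem_bipartiteAbove r).1 hy
      obtain ⟨-, hz1, hz2⟩ := (Finset.mem_bipartiteAbove r).1 hz
      exact eq_of_adj_of_closer hG hy1 hz1 hy2 hz2
  have h4 : (∑ x ∈ A, if x = t then 0 else 1) + 1 = A.card := by
    rw [← Finset.sum_erase_add _ _ htA, if_pos rfl, ← Finset.card_erase_add_one htA,
      Finset.card_eq_sum_ones]
    simp only [add_zero, add_left_inj]
    exact Finset.sum_congr rfl fun x hx => if_neg (Finset.ne_of_mem_erase hx)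
  have h5 := Finset.sum_le_sum h1
  rw [Finset.sum_add_distrib] at h5
  omega

theorem le_sum_card_sdiff_neighbors [DecidableEq V] [G.LocallyFinite] (hG : G.IsTree) {d : ℕ}
    (hd : G.IsRegularOfDegree d) {A : Finset V} (hA : A.Nonempty) :
    d * A.card + 2 ≤ ∑ x ∈ A, (G.neighborFinset x \ A).card + 2 * A.card := by
  have h1 : ∑ x ∈ A, ((G.neighborFinset x \ A).card + (G.neighborFinset x ∩ A).card) =
      ∑ x ∈ A, d := by
    refine Finset.sum_congr rfl fun x _ => ?_
    rw [Finset.card_sdiff_add_card_inter, G.card_neighborFinset_eq_degree, hd x]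
  rw [Finset.sum_add_distrib, Finset.sum_const, smul_eq_mul, mul_comm] at h1
  have := sum_card_inter_neighbors_le hG hA
  omega

/-! ### Descendants and connected sets -/

/-- `y` is a descendant of `x` in the tree rooted at `o`. -/
def IsDescendant (G : SimpleGraph V) (o x y : V) : Prop :=
  G.dist o y = G.dist o x + G.dist x y

theorem IsDescendant.of_adj (hG : G.IsTree) {o x y z : V} (hxy : IsDescendant G o x y)
    (hyz : G.Adj y z) (hd : G.dist o z = G.dist o y + 1) : IsDescendant G o x z := by
  have h1 := hG.connected.dist_triangle (u := o) (v := x) (w := z)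
  have h2 := hG.connected.dist_triangle (u := x) (v := y) (w := z)
  rw [SimpleGraph.dist_eq_one_iff_adj.2 hyz] at h2
  unfold IsDescendant at *
  omega

theorem IsDescendant.parent (hG : G.IsTree) {o x y : V} (hxy : IsDescendant G o x y)
    (hne : y ≠ x) : IsDescendant G o x (parent G o y) ∧ y ≠ o ∧
      G.dist x y = G.dist x (CayleyIsing.parent G o y) + 1 := by
  obtain ⟨z, hz, hdz⟩ := exists_adj_closer hG hne
  have h1 := hG.connected.dist_triangle (u := o) (v := x) (w := z)
  unfold IsDescendant at *
  rcases hG.dist_eq_dist_add_one_of_adj o hz with h2 | h2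
  · obtain rfl := eq_parent hG hz h2
    exact ⟨by omega, ne_root_of_dist h2, hdz⟩
  · omega

/-- Reachability through the vertices of `A`. -/
def ReachIn (G : SimpleGraph V) (A : Finset V) : V → V → Prop :=
  Relation.ReflTransGen fun x y => G.Adj x y ∧ y ∈ A

/-- `A` is a connected finite set of vertices containing `x`. -/
def IsConnSet (G : SimpleGraph V) (A : Finset V) (x : V) : Prop :=
  x ∈ A ∧ ∀ y ∈ A, ReachIn G A x y

theorem ReachIn.mem {A : Finset V} {x y : V} (hx : x ∈ A) (h : ReachIn G A x y) : y ∈ A := by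
  rcases Relation.ReflTransGen.cases_tail h with h | ⟨z, -, h⟩
  · rwa [h]
  · exact h.2

theorem ReachIn.symm {A : Finset V} {x y : V} (hx : x ∈ A) (h : ReachIn G A x y) :
    ReachIn G A y x := by
  induction h with
  | refl => exact Relation.ReflTransGen.refl
  | tail h1 h2 ih => exact Relation.ReflTransGen.head ⟨h2.1.symm, ReachIn.mem hx h1⟩ ih

/-- A connected set has a vertex such that the set contains the parents of all the others. -/
theorem IsConnSet.exists_top (hG : G.IsTree) (o : V) {A : Finset V} {x : V}
    (hA : IsConnSet G A x) : ∃ t ∈ A, ∀ y ∈ A, y ≠ t → y ≠ o ∧ CayleyIsing.parent G o y ∈ A := by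
  obtain ⟨t, htA, ht⟩ := A.exists_min_image (fun x => G.dist o x) ⟨x, hA.1⟩
  refine ⟨t, htA, fun y hy hyt => ?_⟩
  by_contra hcon
  have hyt' : ReachIn G A y t := (hA.2 y hy).symm hA.1 |>.trans (hA.2 t htA)
  -- If the parent of `y` is not available in `A`, a walk inside `A` from `y` cannot leave the
  -- descendants of `y`. So `t` descends from `y`, and minimality of its distance forces `t = y`.
  have key : ∀ z, ReachIn G A y z → IsDescendant G o y z := by
    intro z hz
    induction hz with
    | refl => simp [IsDescendant]
    | tail h1 h2 ih =>
      rename_i w z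
      rcases hG.dist_eq_dist_add_one_of_adj o h2.1 with h3 | h3
      · obtain rfl := eq_parent hG h2.1 h3
        by_cases hwy : w = y
        · subst hwy
          exact absurd ⟨ne_root_of_dist h3, h2.2⟩ hcon
        · exact (ih.parent hG hwy).1
      · exact ih.of_adj hG h2.1 h3
  have h1 := key t hyt'
  have h2 := ht y hy
  unfold IsDescendant at h1
  exact hyt ((hG.connected.dist_eq_zero_iff).1 (by omega))

end Tree


/-! ### Coverings and their dimers -/

section Dimers

variable {G : SimpleGraph V} {k : ℕ} {R : Set (Fin (k + 1) → V)}

theorem IsCovering.eq_of_apply_eq (hR : IsCovering G R) {c c' : Fin (k + 1) → V} (hc : c ∈ R)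
    (hc' : c' ∈ R) {i i' : Fin (k + 1)} (h : c i = c' i') : c = c' ∧ i = i' := by
  obtain rfl : c = c' :=
    (hR.existsUnique (c i)).unique ⟨hc, i, rfl⟩ ⟨hc', i', h.symm⟩
  exact ⟨rfl, (hR.chain c hc).injective h⟩

theorem IsRootedCovering.parent_succ (hG : G.IsTree) {o : V} (hR : IsRootedCovering G o R)
    {c : Fin (k + 1) → V} (hc : c ∈ R) (j : Fin k) :
    c j.succ ≠ o ∧ parent G o (c j.succ) = c j.castSucc := by
  have h1 := hR.away c hc j.succ
  have h2 := hR.away c hc j.castSucc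
  simp only [Fin.val_succ, Fin.val_castSucc] at h1 h2
  have h3 : G.dist o (c j.succ) = G.dist o (c j.castSucc) + 1 := by omega
  exact ⟨ne_root_of_dist h3, (eq_parent hG ((hR.chain c hc).adj j).symm h3).symm⟩

/-- The dimers obtained by taking the bond with index `J c` from each chain `c` of `R`. -/
def dimers (R : Set (Fin (k + 1) → V)) (J : (Fin (k + 1) → V) → Fin k) : Set (Sym2 V) :=
  {e | ∃ c ∈ R, e = chainBond c (J c)}

theorem mem_dimers {J : (Fin (k + 1) → V) → Fin k} {x y : V} :
    s(x, y) ∈ dimers R J ↔ ∃ c ∈ R, (x = c (J c).castSucc ∧ y = c (J c).succ) ∨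
      (x = c (J c).succ ∧ y = c (J c).castSucc) := by
  simp only [dimers, chainBond, Set.mem_ofPred_eq, Sym2.eq_iff]

/-- The dimers form a matching: chains are disjoint, and each contributes one bond. -/
theorem eq_of_mem_dimers (hR : IsCovering G R) {J : (Fin (k + 1) → V) → Fin k} {x y z : V}
    (hy : s(x, y) ∈ dimers R J) (hz : s(x, z) ∈ dimers R J) : y = z := by
  obtain ⟨c, hc, h⟩ := mem_dimers.1 hy
  obtain ⟨c', hc', h'⟩ := mem_dimers.1 hz
  have hne : ∀ j : Fin k, j.castSucc ≠ j.succ := fun j h => by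
    simpa using congrArg Fin.val h
  rcases h with ⟨h1, h2⟩ | ⟨h1, h2⟩ <;> rcases h' with ⟨h3, h4⟩ | ⟨h3, h4⟩ <;>
    obtain ⟨rfl, h5⟩ := hR.eq_of_apply_eq hc hc' (h1.symm.trans h3)
  · rw [h2, h4]
  · exact absurd h5 (hne _)
  · exact absurd h5.symm (hne _)
  · rw [h2, h4]

theorem middleDimers_eq_dimers {m : ℕ} (hk : k = 2 * m + 1) :
    middleDimers R = dimers R fun _ => ⟨m, by omega⟩ := by
  ext e
  constructor
  · rintro ⟨c, hc, j, hj, rfl⟩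
    refine ⟨c, hc, ?_⟩
    congr
    exact Fin.ext (by simp only; omega)
  · rintro ⟨c, hc, rfl⟩
    exact ⟨c, hc, _, by simp only; omega, rfl⟩

/-- The index of the dimer of `splitDimers R l n ρ` in the chain `c`. -/
def splitIndex (l n : ℕ) (hl : l - 1 < k) (hn : n - 1 < k) (ρ : V → Spin)
    (c : Fin (k + 1) → V) : Fin k :=
  if ρ (c 0) = 1 then ⟨l - 1, hl⟩ else ⟨n - 1, hn⟩

theorem splitDimers_eq_dimers {l n : ℕ} (h0l : 0 < l) (h0n : 0 < n) (hl : l - 1 < k)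
    (hn : n - 1 < k) (ρ : V → Spin) :
    splitDimers R l n ρ = dimers R (splitIndex l n hl hn ρ) := by
  ext e
  constructor
  · rintro ⟨c, hc, j, hj, rfl⟩
    refine ⟨c, hc, ?_⟩
    congr
    unfold splitIndex
    split_ifs at hj ⊢ <;> exact Fin.ext (by simp only; omega)
  · rintro ⟨c, hc, rfl⟩
    refine ⟨c, hc, _, ?_, rfl⟩
    unfold splitIndex
    split_ifs <;> simp only <;> omega

/-! ### The Peierls condition -/

/-- The energy barrier: reversing the spins of `σ` in a finite connected set costs at least `κ`
per site. -/
def PeierlsCondition [DecidableEq V] (G : SimpleGraph V) [G.LocallyFinite] (σ : V → Spin)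
    (κ : ℝ) : Prop :=
  ∀ (A : Finset V) (x : V), IsConnSet G A x →
    κ * A.card ≤ ∑ x ∈ A, ∑ y ∈ G.neighborFinset x \ A, spinVal (σ x) * spinVal (σ y)

-- A boundary bond contributes `1`, or `-1` if it is a dimer; hence the number of boundary bonds
-- minus twice the number of boundary dimers.
open Classical in
theorem IsDimerConfig.sum_boundary [DecidableEq V] [G.LocallyFinite] {D : Set (Sym2 V)}
    {σ : V → Spin} (hσ : IsDimerConfig G D σ) (A : Finset V) :
    ∑ x ∈ A, ∑ y ∈ G.neighborFinset x \ A, spinVal (σ x) * spinVal (σ y) =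
      (∑ x ∈ A, (G.neighborFinset x \ A).card : ℕ) -
        2 * (∑ x ∈ A, ((G.neighborFinset x \ A).filter fun y => s(x, y) ∈ D).card : ℕ) := by
  push_cast
  rw [Finset.mul_sum, ← Finset.sum_sub_distrib]
  refine Finset.sum_congr rfl fun x _ => ?_
  have h2 : ∀ y ∈ G.neighborFinset x \ A, spinVal (σ x) * spinVal (σ y) =
      1 - 2 * (if s(x, y) ∈ D then (1 : ℝ) else 0) := by
    intro y hy
    have hxy : G.Adj x y := by
      simpa using (Finset.mem_sdiff.1 hy).1
    have h3 : spinVal (σ x) * spinVal (σ y) = spinVal (σ x * σ y) := by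
      simp [spinVal]
    rw [h3]
    split_ifs with hD
    · rw [(hσ x y hxy).1 hD]
      norm_num [spinVal]
    · rw [(hσ x y hxy).2 hD]
      norm_num [spinVal]
  rw [Finset.sum_congr rfl h2, Finset.sum_sub_distrib, ← Finset.mul_sum, Finset.sum_boole]
  simp

-- Reduces the energy barrier to an upper bound on boundary dimers, by inserting the isoperimetric
-- bound `(d - 2)|A| + 2`.
open Classical in
theorem IsDimerConfig.peierlsCondition [DecidableEq V] [G.LocallyFinite] (hG : G.IsTree) {d : ℕ}
    (hd : G.IsRegularOfDegree d) {D : Set (Sym2 V)} {σ : V → Spin} (hσ : IsDimerConfig G D σ)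
    {κ : ℝ} (h : ∀ (A : Finset V) (x : V), IsConnSet G A x →
      κ * A.card + 2 * (∑ x ∈ A,
        ((G.neighborFinset x \ A).filter fun y => s(x, y) ∈ D).card : ℕ) ≤
          (d - 2) * A.card + 2) :
    PeierlsCondition G σ κ := by
  intro A x hA
  rw [hσ.sum_boundary A]
  have h4 := le_sum_card_sdiff_neighbors hG hd ⟨x, hA.1⟩
  have h5 := h A x hA
  have h6 : (d * A.card + 2 : ℝ) ≤
      (∑ x ∈ A, (G.neighborFinset x \ A).card : ℕ) + 2 * A.card := by exact_mod_cast h4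
  linarith

-- With at most one dimer per vertex, the margin is `(N - 1)|A| + 2 - 2|A|`, which is at least `|A|`
-- since `N ≥ 4`.
open Classical in
theorem IsCovering.peierlsCondition [DecidableEq V] [G.LocallyFinite] (hG : G.IsTree) {N : ℕ}
    (hN : 4 ≤ N) (hd : G.IsRegularOfDegree (N + 1)) (hR : IsCovering G R)
    {J : (Fin (k + 1) → V) → Fin k} {σ : V → Spin} (hσ : IsDimerConfig G (dimers R J) σ) :
    PeierlsCondition G σ 1 := by
  refine hσ.peierlsCondition hG hd fun A x _ => ?_
  have h1 : ∑ x ∈ A, ((G.neighborFinset x \ A).filter fun y => s(x, y) ∈ dimers R J).card ≤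
      ∑ x ∈ A, 1 := by
    refine Finset.sum_le_sum fun x _ => Finset.card_le_one.2 fun y hy z hz => ?_
    exact eq_of_mem_dimers hR (Finset.mem_filter.1 hy).2 (Finset.mem_filter.1 hz).2
  rw [← Finset.card_eq_sum_ones] at h1
  have h2 : ((∑ x ∈ A, ((G.neighborFinset x \ A).filter
    fun y => s(x, y) ∈ dimers R J).card : ℕ) : ℝ) ≤ A.card := by exact_mod_cast h1
  have h3 : (4 : ℝ) ≤ N := by exact_mod_cast hN
  have h4 : (0 : ℝ) ≤ A.card := by positivity
  push_cast at h2 ⊢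
  nlinarith

-- Apart from one exception, each boundary dimer can be charged to three vertices of `A` of its own:
-- the first three of its chain. Climbing from the inner end of the dimer through parents stays in
-- `A` as long as the top `t` is not met, and the chain starts at least three vertices before the
-- dimer's far end. The exception is the dimer of the chain through `t`. With `t` itself not
-- charged, `3 (P - 1) ≤ |A| - 1` for the number `P` of boundary dimers.
open Classical in
theorem IsRootedCovering.card_dimers_le [DecidableEq V] [G.LocallyFinite] (hG : G.IsTree) {o : V}
    (hR : IsRootedCovering G o R) {J : (Fin (k + 1) → V) → Fin k} (hJ : ∀ c, 2 ≤ (J c : ℕ))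
    {A : Finset V} {x : V} (hA : IsConnSet G A x) :
    3 * ∑ x ∈ A, ((G.neighborFinset x \ A).filter fun y => s(x, y) ∈ dimers R J).card ≤
      A.card + 2 := by
  have hk : ∀ i : Fin 3, (i : ℕ) < k + 1 := by
    intro i
    have h1 := hJ fun _ => o
    have h2 := (J fun _ => o).2
    omega
  obtain ⟨t, htA, ht⟩ := hA.exists_top hG o
  let P : Finset V := A.filter fun x => ∃ y, y ∉ A ∧ s(x, y) ∈ dimers R J
  have hP : ∑ x ∈ A, ((G.neighborFinset x \ A).filter fun y => s(x, y) ∈ dimers R J).card ≤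
      P.card := by
    rw [Finset.card_filter]
    refine Finset.sum_le_sum fun x _ => ?_
    split_ifs with hx
    · refine Finset.card_le_one.2 fun y hy z hz => ?_
      exact eq_of_mem_dimers hR.toIsCovering (Finset.mem_filter.1 hy).2 (Finset.mem_filter.1 hz).2
    · refine le_of_eq (Finset.card_eq_zero.2 (Finset.eq_empty_of_forall_notMem fun y hy => hx ?_))
      rw [Finset.mem_filter, Finset.mem_sdiff] at hy
      exact ⟨y, hy.1.2, hy.2⟩
  -- The dimer leaves `A` away from the root, and its chain has its first three vertices in `A`,
  -- none of them being `t`.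
  let good : V → (Fin (k + 1) → V) → Prop := fun x c =>
    c ∈ R ∧ x = c (J c).castSucc ∧ ∀ i : Fin 3, c ⟨i, hk i⟩ ∈ A.erase t
  let Q : Finset V := P.filter fun x => ∃ c, good x c
  have hQ : 3 * Q.card + 1 ≤ A.card := by
    have hQ' : ∀ x : V, ∃ c, x ∈ Q → good x c := by
      intro x
      by_cases hx : x ∈ Q
      · obtain ⟨c, hc⟩ := (Finset.mem_filter.1 hx).2
        exact ⟨c, fun _ => hc⟩
      · exact ⟨fun _ => x, fun h => absurd h hx⟩
    choose C hC using hQ'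
    have h1 : (Q ×ˢ (Finset.univ : Finset (Fin 3))).card ≤ (A.erase t).card := by
      refine Finset.card_le_card_of_injOn (fun p => C p.1 ⟨p.2, hk p.2⟩) ?_ ?_
      · rintro ⟨x, i⟩ hx
        simp only [Finset.coe_product, Set.mem_prod, Finset.mem_coe] at hx
        exact (hC x hx.1).2.2 i
      · rintro ⟨x, i⟩ hx ⟨y, j⟩ hy hxy
        simp only [Finset.coe_product, Set.mem_prod, Finset.mem_coe] at hx hy
        obtain ⟨h2, h3⟩ := hR.toIsCovering.eq_of_apply_eq (hC x hx.1).1 (hC y hy.1).1 hxy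
        rw [Fin.mk.injEq] at h3
        rw [Prod.mk.injEq]
        refine ⟨?_, Fin.ext h3⟩
        rw [(hC x hx.1).2.1, (hC y hy.1).2.1, h2]
    have h2 := Finset.card_erase_add_one htA
    simp only [Finset.card_product, Finset.card_univ, Fintype.card_fin] at h1
    omega
  have hbad : ∀ x ∈ P, x ∉ Q → ∃ c ∈ R, t ∈ Set.range c ∧
      ((x = c (J c).castSucc ∧ c (J c).succ ∉ A) ∨ (x = c (J c).succ ∧ c (J c).castSucc ∉ A)) := by
    intro x hx hxQ
    obtain ⟨hxA, y, hyA, hy⟩ := Finset.mem_filter.1 hx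
    obtain ⟨c, hc, ⟨h1, h2⟩ | ⟨h1, h2⟩⟩ := mem_dimers.1 hy
    · refine ⟨c, hc, ?_, Or.inl ⟨h1, h2 ▸ hyA⟩⟩
      by_contra hcon
      refine hxQ (Finset.mem_filter.2 ⟨hx, c, hc, h1, ?_⟩)
      have hne : ∀ i, c i ≠ t := fun i h => hcon ⟨i, h⟩
      -- Induction on the number `i` of steps back from the inner end of the dimer towards the start
      -- of the chain; each step goes to the parent, which is in `A` because `t` is not on the
      -- chain.
      have hall : ∀ i : ℕ, ∀ j : ℕ, ∀ hj : j < k + 1, j + i = (J c : ℕ) → c ⟨j, hj⟩ ∈ A := by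
        intro i
        induction i with
        | zero =>
          intro j hj hji
          have : (⟨j, hj⟩ : Fin (k + 1)) = (J c).castSucc := Fin.ext (by simpa using hji)
          rw [this, ← h1]
          exact hxA
        | succ i ih =>
          intro j hj hji
          have h3 := ih (j + 1) (by omega) (by omega)
          have h4 := (ht _ h3 (hne _)).2
          have h5 := (hR.parent_succ hG hc ⟨j, by omega⟩).2
          simp only [Fin.succ_mk, Fin.castSucc_mk] at h5
          rwa [h5] at h4
      intro i
      have := hJ c
      exact Finset.mem_erase.2 ⟨hne _, hall ((J c : ℕ) - i) i (hk i) (by omega)⟩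
    -- Here the dimer leaves `A` towards the root, so its inner end has its parent outside `A` and
    -- must be `t`.
    · refine ⟨c, hc, ?_, Or.inr ⟨h1, h2 ▸ hyA⟩⟩
      by_contra hcon
      have h3 := (ht x hxA fun h => hcon ⟨_, h1 ▸ h⟩).2
      rw [h1, (hR.parent_succ hG hc _).2, ← h2] at h3
      exact hyA h3
  -- All exceptional dimers lie on the unique chain through `t`, which has one dimer, and only one
  -- end of that dimer is in `A`.
  have hPQ : (P \ Q).card ≤ 1 := by
    refine Finset.card_le_one.2 fun x hx y hy => ?_
    rw [Finset.mem_sdiff] at hx hy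
    have hxA := (Finset.mem_filter.1 hx.1).1
    have hyA := (Finset.mem_filter.1 hy.1).1
    obtain ⟨c, hc, ⟨i, hi⟩, h1⟩ := hbad x hx.1 hx.2
    obtain ⟨c', hc', ⟨i', hi'⟩, h2⟩ := hbad y hy.1 hy.2
    obtain ⟨rfl, -⟩ := hR.toIsCovering.eq_of_apply_eq hc hc' (hi.trans hi'.symm)
    rcases h1 with ⟨h1, h3⟩ | ⟨h1, h3⟩ <;> rcases h2 with ⟨h2, h4⟩ | ⟨h2, h4⟩
    · rw [h1, h2]
    · exact absurd (h1 ▸ hxA) h4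
    · exact absurd (h1 ▸ hxA) h4
    · rw [h1, h2]
  have h1 : (P \ Q).card + Q.card = P.card :=
    Finset.card_sdiff_add_card_eq_card (Finset.filter_subset _ P)
  omega

/-- The margin is `|A| + 2 - 2(|A| + 2)/3 = (|A| + 2)/3`. -/
theorem IsRootedCovering.peierlsCondition [DecidableEq V] [G.LocallyFinite] (hG : G.IsTree)
    (hd : G.IsRegularOfDegree 3) {o : V} (hR : IsRootedCovering G o R)
    {J : (Fin (k + 1) → V) → Fin k} (hJ : ∀ c, 2 ≤ (J c : ℕ)) {σ : V → Spin}
    (hσ : IsDimerConfig G (dimers R J) σ) : PeierlsCondition G σ (1 / 3) := by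
  classical
  refine hσ.peierlsCondition hG hd fun A x hA => ?_
  have h1 := hR.card_dimers_le hG hJ hA
  have h2 : (3 : ℝ) * ((∑ x ∈ A, ((G.neighborFinset x \ A).filter
      fun y => s(x, y) ∈ dimers R J).card : ℕ) : ℝ) ≤ A.card + 2 := by exact_mod_cast h1
  push_cast at h2 ⊢
  have h4 : (0 : ℝ) ≤ A.card := by positivity
  linarith

end Dimers


/-! ### Energy differences -/

section Energy

theorem bondProd_mk (σ : V → Spin) (x y : V) :
    bondProd σ s(x, y) = spinVal (σ x) * spinVal (σ y) := rfl

variable [DecidableEq V] {G : SimpleGraph V} [G.LocallyFinite]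

theorem spinVal_neg (s : Spin) : spinVal (-s) = -spinVal s := by
  simp [spinVal]

theorem mem_biUnion_incidenceFinset {Λ : Finset V} {x y : V} :
    s(x, y) ∈ Λ.biUnion (fun z => G.incidenceFinset z) ↔ G.Adj x y ∧ (x ∈ Λ ∨ y ∈ Λ) := by
  simp only [Finset.mem_biUnion, SimpleGraph.mem_incidenceFinset, SimpleGraph.mk'_mem_incidenceSet_iff]
  constructor
  · rintro ⟨z, hz, h, rfl | rfl⟩
    · exact ⟨h, Or.inl hz⟩
    · exact ⟨h, Or.inr hz⟩
  · rintro ⟨h, hx | hy⟩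
    · exact ⟨x, hx, h, Or.inl rfl⟩
    · exact ⟨y, hy, h, Or.inr rfl⟩

/-- A change inside `Δ ⊆ Λ` changes the energies in `Δ` and `Λ` by the same amount. -/
theorem energy_sub_energy {Δ Λ : Finset V} (h : Δ ⊆ Λ) {σ τ : V → Spin}
    (hστ : ∀ x ∉ Δ, τ x = σ x) :
    energy G Λ σ - energy G Λ τ = energy G Δ σ - energy G Δ τ := by
  unfold energy
  have h1 : ∑ e ∈ Δ.biUnion (fun x => G.incidenceFinset x), (bondProd σ e - bondProd τ e) =
      ∑ e ∈ Λ.biUnion (fun x => G.incidenceFinset x), (bondProd σ e - bondProd τ e) := by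
    refine Finset.sum_subset (Finset.biUnion_subset_biUnion_of_subset_left _ h) ?_
    intro e
    induction e using Sym2.ind with
    | _ x y =>
      intro h2 h3
      rw [mem_biUnion_incidenceFinset] at h2 h3
      rw [bondProd_mk, bondProd_mk, hστ x fun h => h3 ⟨h2.1, Or.inl h⟩,
        hστ y fun h => h3 ⟨h2.1, Or.inr h⟩, sub_self]
  rw [Finset.sum_sub_distrib, Finset.sum_sub_distrib] at h1
  linarith

theorem energy_congr {Λ : Finset V} {σ τ : V → Spin}
    (h : ∀ x y, x ∈ Λ → G.Adj x y → σ x = τ x ∧ σ y = τ y) : energy G Λ σ = energy G Λ τ := by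
  unfold energy
  refine congrArg Neg.neg (Finset.sum_congr rfl fun e => ?_)
  induction e using Sym2.ind with
  | _ x y =>
    intro he
    rw [mem_biUnion_incidenceFinset] at he
    rw [bondProd_mk, bondProd_mk]
    rcases he with ⟨hxy, hx | hy⟩
    · rw [(h x y hx hxy).1, (h x y hx hxy).2]
    · rw [(h y x hy hxy.symm).1, (h y x hy hxy.symm).2]

/-- The configuration `σ` reversed in `A`. -/
def flip (A : Finset V) (σ : V → Spin) : V → Spin :=
  fun x => if x ∈ A then -σ x else σ x

/-- Bonds with both ends in `A` keep their energy and those leaving `A` change sign. Ordered pairs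
`(x, y)` with `x ∈ A`, `y ∉ A` enumerate the latter without repetition. -/
theorem energy_flip_sub (A : Finset V) (σ : V → Spin) :
    energy G A (flip A σ) - energy G A σ =
      2 * ∑ x ∈ A, ∑ y ∈ G.neighborFinset x \ A, spinVal (σ x) * spinVal (σ y) := by
  let F : Finset (Sigma fun _ : V => V) := A.sigma fun x => G.neighborFinset x \ A
  let g : Sym2 V → ℝ := fun e => bondProd σ e - bondProd (flip A σ) e
  have hF : ∀ p ∈ F, p.1 ∈ A ∧ G.Adj p.1 p.2 ∧ p.2 ∉ A := by
    rintro ⟨x, y⟩ hp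
    simpa [F] using hp
  have h1 : ∑ e ∈ F.image (fun p => s(p.1, p.2)), g e =
      ∑ e ∈ A.biUnion (fun x => G.incidenceFinset x), g e := by
    refine Finset.sum_subset ?_ ?_
    · intro e he
      obtain ⟨p, hp, rfl⟩ := Finset.mem_image.1 he
      exact mem_biUnion_incidenceFinset.2 ⟨(hF p hp).2.1, Or.inl (hF p hp).1⟩
    · intro e
      induction e using Sym2.ind with
      | _ x y =>
        intro h2 h3
        rw [mem_biUnion_incidenceFinset] at h2
        have h4 : x ∈ A ∧ y ∈ A := by
          by_contra hcon
          refine h3 (Finset.mem_image.2 ?_)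
          rcases h2 with ⟨hxy, hx | hy⟩
          · exact ⟨⟨x, y⟩, by simp [F, hx, hxy]; tauto, rfl⟩
          · exact ⟨⟨y, x⟩, by simp [F, hy, hxy.symm]; tauto, Sym2.eq_swap⟩
        simp only [g, bondProd_mk, flip, if_pos h4.1, if_pos h4.2, spinVal_neg]
        ring
  have h2 : ∑ e ∈ F.image (fun p => s(p.1, p.2)), g e = ∑ p ∈ F, g s(p.1, p.2) := by
    refine Finset.sum_image ?_
    rintro ⟨x, y⟩ hp ⟨z, w⟩ hq hpq
    have hp' := hF _ hp
    have hq' := hF _ hq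
    rcases Sym2.eq_iff.1 hpq with ⟨h3, h4⟩ | ⟨h3, h4⟩
    · simp only at h3 h4
      rw [h3, h4]
    · simp only at h3 h4 hp' hq'
      exact absurd (h3 ▸ hp'.1) hq'.2.2
  have h3 : energy G A (flip A σ) - energy G A σ =
      ∑ e ∈ A.biUnion (fun x => G.incidenceFinset x), g e := by
    unfold energy
    rw [Finset.sum_sub_distrib]
    ring
  rw [h3, ← h1, h2, Finset.sum_sigma, Finset.mul_sum]
  refine Finset.sum_congr rfl fun x hx => ?_
  rw [Finset.mul_sum]
  refine Finset.sum_congr rfl fun y hy => ?_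
  have hy' := (Finset.mem_sdiff.1 hy).2
  simp only [g, bondProd_mk, flip, if_pos hx, if_neg hy', spinVal_neg]
  ring

end Energy

/-! ### Finite volume Gibbs distributions -/

section Gibbs

theorem isClopen_setOf_apply_eq (x : V) (s : Spin) : IsClopen {η : V → Spin | η x = s} :=
  (isClopen_discrete {s}).preimage (continuous_apply x)

variable [DecidableEq V]

theorem glue_of_mem {Λ : Finset V} {x : V} (h : x ∈ Λ) (τ : Λ → Spin) (η : V → Spin) :
    glue Λ τ η x = τ ⟨x, h⟩ := dif_pos h

theorem glue_of_notMem {Λ : Finset V} {x : V} (h : x ∉ Λ) (τ : Λ → Spin) (η : V → Spin) :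
    glue Λ τ η x = η x := dif_neg h

theorem glue_restrict {Λ : Finset V} {η ω : V → Spin} (h : ∀ x ∉ Λ, ω x = η x) :
    glue Λ (fun x => ω x) η = ω := by
  funext x
  by_cases hx : x ∈ Λ
  · rw [glue_of_mem hx]
  · rw [glue_of_notMem hx, h x hx]

theorem glue_congr {Λ : Finset V} (τ : Λ → Spin) {η ω : V → Spin} (h : ∀ x ∉ Λ, η x = ω x) :
    glue Λ τ η = glue Λ τ ω := by
  funext x
  by_cases hx : x ∈ Λ
  · rw [glue_of_mem hx, glue_of_mem hx]
  · rw [glue_of_notMem hx, glue_of_notMem hx, h x hx]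

variable (G : SimpleGraph V) [G.LocallyFinite]

theorem partitionFn_pos (β : ℝ) (Λ : Finset V) (η : V → Spin) : 0 < partitionFn G β Λ η :=
  Finset.sum_pos (fun _ _ => Real.exp_pos _) Finset.univ_nonempty

/-- The probability of the spins `τ` under the finite volume Gibbs distribution. -/
noncomputable def gibbsProb (β : ℝ) (Λ : Finset V) (η : V → Spin) (τ : Λ → Spin) : ℝ :=
  Real.exp (-β * energy G Λ (glue Λ τ η)) / partitionFn G β Λ η

theorem gibbsProb_nonneg (β : ℝ) (Λ : Finset V) (η : V → Spin) (τ : Λ → Spin) :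
    0 ≤ gibbsProb G β Λ η τ :=
  div_nonneg (Real.exp_pos _).le (partitionFn_pos G β Λ η).le

theorem sum_gibbsProb (β : ℝ) (Λ : Finset V) (η : V → Spin) :
    ∑ τ, gibbsProb G β Λ η τ = 1 := by
  unfold gibbsProb
  rw [← Finset.sum_div]
  exact div_self (partitionFn_pos G β Λ η).ne'

theorem sum_toNNReal_gibbsProb (β : ℝ) (Λ : Finset V) (η : V → Spin) :
    ∑ τ, (gibbsProb G β Λ η τ).toNNReal = 1 := by
  rw [← Real.toNNReal_sum_of_nonneg fun τ _ => gibbsProb_nonneg G β Λ η τ, sum_gibbsProb,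
    Real.toNNReal_one]

theorem gibbsKernel_eq (β : ℝ) (Λ : Finset V) (η : V → Spin) :
    gibbsKernel G β Λ η = ∑ τ : Λ → Spin,
      ((gibbsProb G β Λ η τ).toNNReal : ENNReal) • Measure.dirac (glue Λ τ η) := rfl

theorem gibbsKernel_apply (β : ℝ) (Λ : Finset V) (η : V → Spin) {A : Set (V → Spin)}
    (hA : MeasurableSet A) :
    gibbsKernel G β Λ η A = ∑ τ : Λ → Spin,
      ((gibbsProb G β Λ η τ).toNNReal : ENNReal) * A.indicator 1 (glue Λ τ η) := by
  rw [gibbsKernel_eq, Measure.finsetSum_apply]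
  refine Finset.sum_congr rfl fun τ _ => ?_
  rw [Measure.smul_apply, Measure.dirac_apply' _ hA, smul_eq_mul]

theorem lintegral_gibbsKernel (β : ℝ) (Λ : Finset V) (η : V → Spin) {f : (V → Spin) → ENNReal}
    (hf : Measurable f) :
    ∫⁻ ω, f ω ∂gibbsKernel G β Λ η = ∑ τ : Λ → Spin,
      ((gibbsProb G β Λ η τ).toNNReal : ENNReal) * f (glue Λ τ η) := by
  rw [gibbsKernel_eq, lintegral_finsetSum_measure]
  refine Finset.sum_congr rfl fun τ _ => ?_
  rw [lintegral_smul_measure, lintegral_dirac' _ hf, smul_eq_mul]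

instance (β : ℝ) (Λ : Finset V) (η : V → Spin) : IsProbabilityMeasure (gibbsKernel G β Λ η) where
  measure_univ := by
    rw [gibbsKernel_apply G β Λ η MeasurableSet.univ]
    simp only [Set.indicator_univ, Pi.one_apply, mul_one]
    exact_mod_cast sum_toNNReal_gibbsProb G β Λ η

theorem continuous_glue (Λ : Finset V) (τ : Λ → Spin) : Continuous (glue Λ τ) := by
  refine continuous_pi fun x => ?_
  by_cases hx : x ∈ Λ
  · simpa only [glue_of_mem hx] using continuous_const
  · simpa only [glue_of_notMem hx] using continuous_apply x

theorem continuous_energy (Λ : Finset V) : Continuous (energy G Λ) := by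
  unfold energy
  refine (continuous_finsetSum _ fun e _ => ?_).neg
  induction e using Sym2.ind with
  | _ x y =>
    have h : Continuous spinVal := continuous_of_discreteTopology
    exact (h.comp (continuous_apply x)).mul (h.comp (continuous_apply y))

theorem continuous_gibbsProb (β : ℝ) (Λ : Finset V) (τ : Λ → Spin) :
    Continuous fun η => gibbsProb G β Λ η τ := by
  have h : ∀ τ : Λ → Spin, Continuous fun η => Real.exp (-β * energy G Λ (glue Λ τ η)) :=
    fun τ => Real.continuous_exp.comp
      (continuous_const.mul ((continuous_energy G Λ).comp (continuous_glue Λ τ)))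
  exact (h τ).div (continuous_finsetSum _ fun τ _ => h τ) fun η => (partitionFn_pos G β Λ η).ne'

theorem measurable_gibbsKernel [Countable V] (β : ℝ) (Λ : Finset V) :
    Measurable (gibbsKernel G β Λ) := by
  refine Measure.measurable_of_measurable_coe _ fun A hA => ?_
  simp only [gibbsKernel_apply G β Λ _ hA]
  refine Finset.measurable_sum _ fun τ _ => Measurable.mul ?_ ?_
  · exact (measurable_real_toNNReal.comp (continuous_gibbsProb G β Λ τ).measurable).coe_nnreal_ennreal
  · exact (measurable_one.indicator hA).comp (continuous_glue Λ τ).measurable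

variable {G}

/-- Detailed balance for the exchange of the spins in `Δ ⊆ Λ`. -/
theorem gibbsProb_mul_gibbsProb (β : ℝ) {Δ Λ : Finset V} (hΔ : Δ ⊆ Λ) {σ ω ω' : V → Spin}
    (hω : ∀ x ∉ Λ, ω x = σ x) (h : ∀ x ∉ Δ, ω' x = ω x) :
    gibbsProb G β Λ σ (fun x => ω x) * gibbsProb G β Δ ω (fun x => ω' x) =
      gibbsProb G β Λ σ (fun x => ω' x) * gibbsProb G β Δ ω' (fun x => ω x) := by
  have hω' : ∀ x ∉ Λ, ω' x = σ x := fun x hx => (h x fun h => hx (hΔ h)).trans (hω x hx)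
  have h1 : partitionFn G β Δ ω' = partitionFn G β Δ ω := by
    unfold partitionFn
    exact Finset.sum_congr rfl fun τ _ => by rw [glue_congr τ h]
  unfold gibbsProb
  rw [glue_restrict hω, glue_restrict hω', glue_restrict h, glue_restrict fun x hx => (h x hx).symm,
    h1, div_mul_div_comm, div_mul_div_comm, ← Real.exp_add, ← Real.exp_add]
  have h2 := energy_sub_energy (G := G) hΔ h
  congr 2
  linear_combination (-β) * h2

/-- Consistency of the finite volume Gibbs distributions. -/
theorem sum_gibbsProb_glue (β : ℝ) {Δ Λ : Finset V} (hΔ : Δ ⊆ Λ) (σ : V → Spin)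
    (f : (V → Spin) → NNReal) :
    ∑ τ : Λ → Spin, (gibbsProb G β Λ σ τ).toNNReal * ∑ τ' : Δ → Spin,
      (gibbsProb G β Δ (glue Λ τ σ) τ').toNNReal * f (glue Δ τ' (glue Λ τ σ)) =
    ∑ τ : Λ → Spin, (gibbsProb G β Λ σ τ).toNNReal * f (glue Λ τ σ) := by
  -- Resampling in `Δ` is a reversible step: `ι` exchanges the old and the new spins in `Δ`, and
  -- detailed balance says that it preserves the joint weight `K`.
  let ι : (Λ → Spin) × (Δ → Spin) → (Λ → Spin) × (Δ → Spin) := fun p =>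
    (fun x => glue Δ p.2 (glue Λ p.1 σ) x, fun x => glue Λ p.1 σ x)
  have hout : ∀ (τ : Λ → Spin), ∀ x ∉ Λ, glue Λ τ σ x = σ x := fun τ x hx => glue_of_notMem hx _ _
  have hout' : ∀ (τ : Λ → Spin) (τ' : Δ → Spin), ∀ x ∉ Λ, glue Δ τ' (glue Λ τ σ) x = σ x :=
    fun τ τ' x hx => by rw [glue_of_notMem fun h => hx (hΔ h), hout τ x hx]
  have hΔout : ∀ (τ : Λ → Spin) (τ' : Δ → Spin), ∀ x ∉ Δ,
      glue Δ τ' (glue Λ τ σ) x = glue Λ τ σ x :=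
    fun τ τ' x hx => glue_of_notMem hx _ _
  have hrest : ∀ (Γ : Finset V) (τ : Γ → Spin) (η : V → Spin), (fun x : Γ => glue Γ τ η x) = τ :=
    fun Γ τ η => funext fun x => glue_of_mem x.2 _ _
  have h1 : ∀ p, glue Λ (ι p).1 σ = glue Δ p.2 (glue Λ p.1 σ) :=
    fun p => glue_restrict (hout' p.1 p.2)
  have h2 : ∀ p, glue Δ (ι p).2 (glue Λ (ι p).1 σ) = glue Λ p.1 σ := fun p => by
    rw [h1]
    exact glue_restrict fun x hx => (hΔout p.1 p.2 x hx).symm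
  have hι : Function.Involutive ι := by
    intro p
    refine Prod.ext ?_ ?_
    · change (fun x : Λ => glue Δ (ι p).2 (glue Λ (ι p).1 σ) x) = p.1
      rw [h2, hrest]
    · change (fun x : Δ => glue Λ (ι p).1 σ x) = p.2
      rw [h1, hrest]
  let K : (Λ → Spin) × (Δ → Spin) → NNReal := fun p =>
    (gibbsProb G β Λ σ p.1).toNNReal * (gibbsProb G β Δ (glue Λ p.1 σ) p.2).toNNReal
  have hK : ∀ p, K (ι p) = K p := by
    intro p
    have h3 := gibbsProb_mul_gibbsProb (G := G) β hΔ (hout p.1) (hΔout p.1 p.2)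
    rw [hrest, hrest] at h3
    simp only [K]
    rw [← Real.toNNReal_mul (gibbsProb_nonneg _ _ _ _ _),
      ← Real.toNNReal_mul (gibbsProb_nonneg _ _ _ _ _), h3, h1]
  calc _ = ∑ p : (Λ → Spin) × (Δ → Spin), K p * f (glue Δ p.2 (glue Λ p.1 σ)) := by
        rw [Fintype.sum_prod_type]
        refine Finset.sum_congr rfl fun τ _ => ?_
        rw [Finset.mul_sum]
        exact Finset.sum_congr rfl fun τ' _ => (mul_assoc _ _ _).symm
    _ = ∑ p : (Λ → Spin) × (Δ → Spin), K p * f (glue Λ p.1 σ) := by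
        rw [← Equiv.sum_comp hι.toPerm]
        refine Finset.sum_congr rfl fun p _ => ?_
        change K (ι p) * f (glue Δ (ι p).2 (glue Λ (ι p).1 σ)) = _
        rw [hK, h2]
    _ = _ := by
        rw [Fintype.sum_prod_type]
        refine Finset.sum_congr rfl fun τ _ => ?_
        simp only [K]
        rw [← Finset.sum_mul, ← Finset.mul_sum, sum_toNNReal_gibbsProb, mul_one]

/-! ### Infinite volume Gibbs states -/

variable (G)

/-- The conditional expectation of `f` given the spins outside `Δ`. -/
noncomputable def gibbsOp (β : ℝ) (Δ : Finset V) (f : BoundedContinuousFunction (V → Spin) NNReal) :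
    BoundedContinuousFunction (V → Spin) NNReal :=
  BoundedContinuousFunction.mkOfCompact
    ⟨fun η => ∑ τ : Δ → Spin, (gibbsProb G β Δ η τ).toNNReal * f (glue Δ τ η),
      continuous_finsetSum _ fun τ _ =>
        (continuous_real_toNNReal.comp (continuous_gibbsProb G β Δ τ)).mul
          (f.continuous.comp (continuous_glue Δ τ))⟩

theorem gibbsOp_apply (β : ℝ) (Δ : Finset V) (f : BoundedContinuousFunction (V → Spin) NNReal)
    (η : V → Spin) : gibbsOp G β Δ f η =
      ∑ τ : Δ → Spin, (gibbsProb G β Δ η τ).toNNReal * f (glue Δ τ η) := rfl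

variable [Countable V]

/-- The finite volume Gibbs distribution as a probability measure. -/
noncomputable def gibbsPM (β : ℝ) (Λ : Finset V) (η : V → Spin) : ProbabilityMeasure (V → Spin) :=
  ⟨gibbsKernel G β Λ η, inferInstance⟩

theorem lintegral_gibbsKernel_bcf (β : ℝ) (Λ : Finset V) (η : V → Spin)
    (f : BoundedContinuousFunction (V → Spin) NNReal) :
    ∫⁻ ω, f ω ∂gibbsKernel G β Λ η = gibbsOp G β Λ f η := by
  rw [lintegral_gibbsKernel G β Λ η f.continuous.measurable.coe_nnreal_ennreal, gibbsOp_apply]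
  push_cast
  rfl

theorem isGibbsState_of_tendsto (β : ℝ) {U : Filter (Finset V)} [U.NeBot] (hU : U ≤ atTop)
    {σ : V → Spin} {μ : ProbabilityMeasure (V → Spin)}
    (hμ : Tendsto (fun Λ => gibbsPM G β Λ σ) U (𝓝 μ)) : IsGibbsState G β μ := by
  intro Δ A hA
  have hm := measurable_gibbsKernel G β Δ
  rw [← Measure.bind_apply hA hm.aemeasurable]
  have : IsProbabilityMeasure ((μ : Measure (V → Spin)).bind (gibbsKernel G β Δ)) :=
    ⟨by
      rw [Measure.bind_apply MeasurableSet.univ hm.aemeasurable]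
      simp⟩
  have key : (μ : Measure (V → Spin)).bind (gibbsKernel G β Δ) = μ := by
    -- The conditional expectation `gibbsOp G β Δ f` of a continuous `f` is again continuous, so
    -- weak convergence applies to both sides; they agree along the net as soon as `Λ ⊇ Δ`.
    refine ext_of_forall_lintegral_eq_of_IsFiniteMeasure fun f => ?_
    rw [Measure.lintegral_bind hm.aemeasurable
      f.continuous.measurable.coe_nnreal_ennreal.aemeasurable]
    simp only [lintegral_gibbsKernel_bcf]
    rw [ProbabilityMeasure.tendsto_iff_forall_lintegral_tendsto] at hμ
    refine tendsto_nhds_unique_of_eventuallyEq (hμ (gibbsOp G β Δ f)) (hμ f) ?_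
    filter_upwards [hU (eventually_ge_atTop Δ)] with Λ hΛ
    change ∫⁻ ω, gibbsOp G β Δ f ω ∂gibbsKernel G β Λ σ = ∫⁻ ω, f ω ∂gibbsKernel G β Λ σ
    rw [lintegral_gibbsKernel_bcf, lintegral_gibbsKernel_bcf, gibbsOp_apply, gibbsOp_apply]
    simp only [gibbsOp_apply]
    rw [sum_gibbsProb_glue β hΛ]
  rw [key]

/-- An infinite volume Gibbs state inheriting uniform finite volume bounds. -/
theorem exists_isGibbsState (β : ℝ) (σ : V → Spin) {ε : NNReal}
    (h : ∀ Λ x, gibbsPM G β Λ σ {η | η x = σ x}ᶜ ≤ ε) :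
    ∃ μ : ProbabilityMeasure (V → Spin), IsGibbsState G β μ ∧ ∀ x, μ {η | η x = σ x}ᶜ ≤ ε := by
  -- An ultrafilter finer than `atTop` turns the cluster point into a genuine limit. The events in
  -- question are clopen, so their probabilities converge.
  obtain ⟨μ, hμ⟩ := exists_clusterPt_of_compactSpace (map (fun Λ => gibbsPM G β Λ σ) atTop)
  obtain ⟨U, hU, hμ⟩ := mapClusterPt_iff_ultrafilter.1 hμ
  refine ⟨μ, isGibbsState_of_tendsto G β hU hμ, fun x => ?_⟩
  have h1 := ProbabilityMeasure.tendsto_measure_of_null_frontier_of_tendsto hμ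
    (E := {η | η x = σ x}ᶜ) (by
      rw [(isClopen_setOf_apply_eq x (σ x)).compl.frontier_eq]
      simp)
  exact le_of_tendsto h1 (Eventually.of_forall fun Λ => h Λ x)

end Gibbs


/-! ### Connected components of finite sets and their number -/

section Components

variable {G : SimpleGraph V}

open Classical in
/-- The connected component of `x` in the finite set `S`. -/
noncomputable def component (G : SimpleGraph V) (S : Finset V) (x : V) : Finset V :=
  S.filter fun y => ReachIn G S x y

theorem component_subset (S : Finset V) (x : V) : component G S x ⊆ S := by
  classical
  exact Finset.filter_subset _ _

theorem mem_component {S : Finset V} {x y : V} (hx : x ∈ S) :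
    y ∈ component G S x ↔ ReachIn G S x y := by
  classical
  exact Finset.mem_filter.trans ⟨fun h => h.2, fun h => ⟨h.mem hx, h⟩⟩

theorem isConnSet_component {S : Finset V} {x : V} (hx : x ∈ S) :
    IsConnSet G (component G S x) x := by
  refine ⟨(mem_component hx).2 Relation.ReflTransGen.refl, fun y hy => ?_⟩
  rw [mem_component hx] at hy
  induction hy with
  | refl => exact Relation.ReflTransGen.refl
  | tail h1 h2 ih => exact ih.tail ⟨h2.1, (mem_component hx).2 (h1.tail h2)⟩

theorem notMem_of_adj_component {S : Finset V} {x y z : V} (hx : x ∈ S)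
    (hy : y ∈ component G S x) (hyz : G.Adj y z) (hz : z ∉ component G S x) : z ∉ S := by
  intro hzS
  rw [mem_component hx] at hy hz
  exact hz (hy.tail ⟨hyz, hzS⟩)

theorem component_eq {S A : Finset V} {x : V} (hA : IsConnSet G A x) (hAS : A ⊆ S)
    (h : ∀ y ∈ A, ∀ z, G.Adj y z → z ∉ A → z ∉ S) : component G S x = A := by
  ext y
  rw [mem_component (hAS hA.1)]
  constructor
  · intro hy
    induction hy with
    | refl => exact hA.1
    | tail _ h2 ih =>
      by_contra hcon
      exact h _ ih _ h2.1 hcon h2.2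
  · intro hy
    exact Relation.ReflTransGen.mono (fun a b hab => ⟨hab.1, hAS hab.2⟩) _ _ (hA.2 y hy)

open Classical in
/-- The connected sets inside `Λ` that contain `x`. -/
noncomputable def connSets (G : SimpleGraph V) (Λ : Finset V) (x : V) : Finset (Finset V) :=
  Λ.powerset.filter fun A => IsConnSet G A x

theorem mem_connSets {Λ A : Finset V} {x : V} :
    A ∈ connSets G Λ x ↔ A ⊆ Λ ∧ IsConnSet G A x := by
  classical
  rw [connSets, Finset.mem_filter, Finset.mem_powerset]

/-- There are at most exponentially many connected sets of a given size. -/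
theorem sum_connSets_le [DecidableEq V] [G.LocallyFinite] {d : ℕ} (hd : G.IsRegularOfDegree d)
    (Λ : Finset V) (x : V) :
    ∑ A ∈ connSets G Λ x, ((1 : ℝ) / 2 ^ (d + 1)) ^ A.card ≤ 1 := by
  let bd : Finset V → Finset V := fun A => A.biUnion (fun y => G.neighborFinset y) \ A
  have hbd : ∀ A, (bd A).card ≤ d * A.card := by
    intro A
    refine (Finset.card_le_card Finset.sdiff_subset).trans ?_
    refine (Finset.card_biUnion_le_card_mul _ _ d fun y _ => ?_).trans_eq (mul_comm _ _)
    rw [G.card_neighborFinset_eq_degree, hd y]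
  have hsub : ∀ A ∈ connSets G Λ x, A ⊆ Λ \ bd A := by
    intro A hA y hy
    exact Finset.mem_sdiff.2 ⟨(mem_connSets.1 hA).1 hy, fun h => (Finset.mem_sdiff.1 h).2 hy⟩
  -- A percolation count: among the subsets `S` of `Λ`, those in which the component of `x` is `A`
  -- include all `S` with `A ⊆ S` that avoid the outer boundary of `A`. These families are disjoint
  -- for different `A`, and each has at least `2 ^ (|Λ| - (d + 1)|A|)` members because the outer
  -- boundary has at most `d |A|` vertices.
  have hdisj : Set.PairwiseDisjoint (connSets G Λ x : Set (Finset V))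
      fun A => Finset.Icc A (Λ \ bd A) := by
    have key : ∀ A ∈ connSets G Λ x, ∀ S ∈ Finset.Icc A (Λ \ bd A), component G S x = A := by
      intro A hA S hS
      rw [Finset.mem_Icc] at hS
      refine component_eq (mem_connSets.1 hA).2 hS.1 fun y hy z hyz hz hzS => ?_
      refine (Finset.mem_sdiff.1 (hS.2 hzS)).2 (Finset.mem_sdiff.2 ⟨?_, hz⟩)
      exact Finset.mem_biUnion.2 ⟨y, hy, by simpa using hyz⟩
    intro A hA B hB hAB
    rw [Function.onFun, Finset.disjoint_left]
    intro S hS hS'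
    exact hAB ((key A hA S hS).symm.trans (key B hB S hS'))
  have h1 : ∑ A ∈ connSets G Λ x, (Finset.Icc A (Λ \ bd A)).card ≤ 2 ^ Λ.card := by
    rw [← Finset.card_biUnion hdisj, ← Finset.card_powerset]
    refine Finset.card_le_card fun S hS => ?_
    obtain ⟨A, -, hS⟩ := Finset.mem_biUnion.1 hS
    exact Finset.mem_powerset.2 ((Finset.mem_Icc.1 hS).2.trans Finset.sdiff_subset)
  have h2 : ∀ A ∈ connSets G Λ x, (2 : ℝ) ^ Λ.card * ((1 : ℝ) / 2 ^ (d + 1)) ^ A.card ≤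
      (Finset.Icc A (Λ \ bd A)).card := by
    intro A hA
    rw [Finset.card_Icc_finset (hsub A hA), one_div, inv_pow, ← div_eq_mul_inv,
      div_le_iff₀ (by positivity), ← pow_mul]
    push_cast
    rw [← pow_add]
    refine pow_le_pow_right₀ one_le_two ?_
    have h3 := Finset.le_card_sdiff (bd A) Λ
    have h4 := hbd A
    have h5 := Finset.card_le_card (hsub A hA)
    have h6 : (d + 1) * A.card = d * A.card + A.card := by ring
    omega
  have h3 := Finset.sum_le_sum h2
  rw [← Finset.mul_sum] at h3
  have h4 : ((∑ A ∈ connSets G Λ x, (Finset.Icc A (Λ \ bd A)).card : ℕ) : ℝ) ≤ 2 ^ Λ.card := by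
    exact_mod_cast h1
  push_cast at h4
  exact le_of_mul_le_mul_left (by linarith) (by positivity : (0 : ℝ) < 2 ^ Λ.card)

end Components

/-! ### The Peierls estimate -/

section Peierls

variable [DecidableEq V] {G : SimpleGraph V} [G.LocallyFinite]

theorem flip_flip (A : Finset V) (σ : V → Spin) : flip A (flip A σ) = σ := by
  funext x
  by_cases hx : x ∈ A <;> simp [flip, hx]

/-- The sites of `Λ` where the spins `τ` differ from `σ`. -/
def disagreement (Λ : Finset V) (σ : V → Spin) (τ : Λ → Spin) : Finset V :=
  Λ.filter fun y => glue Λ τ σ y ≠ σ y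

/-- Reversing the component `A` of the disagreement set is injective and restores `σ` on `A`; just
outside `A` the spins already agree with `σ`. So the energy drops by the full barrier of `σ`, at
least `2κ|A|`. -/
theorem sum_exp_le_of_component {σ : V → Spin} {κ : ℝ} (hσ : PeierlsCondition G σ κ) {β : ℝ}
    (hβ : 0 ≤ β) {Λ A : Finset V} {x : V} (hA : A ∈ connSets G Λ x) (F : Finset (Λ → Spin))
    (hF : ∀ τ ∈ F, x ∈ disagreement Λ σ τ ∧ component G (disagreement Λ σ τ) x = A) :
    ∑ τ ∈ F, Real.exp (-β * energy G Λ (glue Λ τ σ)) ≤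
      Real.exp (-2 * β * κ) ^ A.card * partitionFn G β Λ σ := by
  have hAΛ := (mem_connSets.1 hA).1
  let φ : (Λ → Spin) → (Λ → Spin) := fun τ y => flip A (glue Λ τ σ) y
  have h1 : ∀ τ, glue Λ (φ τ) σ = flip A (glue Λ τ σ) := by
    intro τ
    refine glue_restrict fun y hy => ?_
    rw [flip, if_neg fun h => hy (hAΛ h), glue_of_notMem hy]
  have hφ : Function.Involutive φ := by
    intro τ
    funext y
    change flip A (glue Λ (φ τ) σ) y = τ y
    rw [h1, flip_flip, glue_of_mem y.2]
  have h2 : ∀ τ ∈ F, Real.exp (-β * energy G Λ (glue Λ τ σ)) ≤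
      Real.exp (-2 * β * κ) ^ A.card * Real.exp (-β * energy G Λ (glue Λ (φ τ) σ)) := by
    intro τ hτ
    obtain ⟨hx, hcomp⟩ := hF τ hτ
    have h3 : ∀ y ∈ A, flip A (glue Λ τ σ) y = σ y := by
      intro y hy
      have h4 : y ∈ disagreement Λ σ τ := component_subset _ x (hcomp ▸ hy)
      have h5 := (Finset.mem_filter.1 h4).2
      rw [flip, if_pos hy, Int.units_ne_iff_eq_neg.1 h5, neg_neg]
    have h4 : ∀ y ∈ A, ∀ z ∈ G.neighborFinset y \ A, flip A (glue Λ τ σ) z = σ z := by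
      intro y hy z hz
      obtain ⟨hyz, hzA⟩ := Finset.mem_sdiff.1 hz
      rw [SimpleGraph.mem_neighborFinset] at hyz
      have h5 := notMem_of_adj_component hx (hcomp ▸ hy) hyz (hcomp ▸ hzA)
      rw [flip, if_neg hzA]
      by_contra hcon
      refine h5 (Finset.mem_filter.2 ⟨?_, hcon⟩)
      by_contra hzΛ
      exact hcon (glue_of_notMem hzΛ _ _)
    have h5 := energy_flip_sub (G := G) A (flip A (glue Λ τ σ))
    rw [flip_flip, Finset.sum_congr rfl fun y hy => Finset.sum_congr rfl fun z hz => by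
      rw [h3 y hy, h4 y hy z hz]] at h5
    have h6 := energy_sub_energy (G := G) hAΛ (σ := glue Λ τ σ) (τ := flip A (glue Λ τ σ))
      fun y hy => by rw [flip, if_neg hy]
    have h7 := hσ A x (mem_connSets.1 hA).2
    rw [h1, ← Real.exp_nat_mul, ← Real.exp_add, Real.exp_le_exp]
    have h8 := mul_le_mul_of_nonneg_left h7 hβ
    have h9 : energy G Λ (glue Λ τ σ) = energy G Λ (flip A (glue Λ τ σ)) + 2 * ∑ y ∈ A,
        ∑ z ∈ G.neighborFinset y \ A, spinVal (σ y) * spinVal (σ z) := by linarith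
    rw [h9]
    linarith
  refine (Finset.sum_le_sum h2).trans ?_
  rw [← Finset.mul_sum]
  refine mul_le_mul_of_nonneg_left ?_ (by positivity)
  unfold partitionFn
  rw [← Equiv.sum_comp hφ.toPerm]
  exact Finset.sum_le_sum_of_subset_of_nonneg (Finset.subset_univ _)
    fun _ _ _ => (Real.exp_pos _).le

/-- If the spin at `x` is wrong, `x` lies in a component of the disagreement set. Summing the
Peierls weights over all possible components converges once `exp (-2βκ)` beats the entropy `2 ^ (d +
1)` per site; since a component is non-empty, one factor `ε` is left over. -/
theorem gibbsPM_compl_le [Countable V] {d : ℕ} (hd : G.IsRegularOfDegree d) {σ : V → Spin} {κ : ℝ}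
    (hσ : PeierlsCondition G σ κ) {β : ℝ} (hβ : 0 ≤ β) {ε : NNReal} (hε : ε ≤ 1)
    (hβε : Real.exp (-2 * β * κ) ≤ ε * (1 / 2 ^ (d + 1))) (Λ : Finset V) (x : V) :
    gibbsPM G β Λ σ {η | η x = σ x}ᶜ ≤ ε := by
  classical
  let B : Finset (Λ → Spin) := Finset.univ.filter fun τ => glue Λ τ σ x ≠ σ x
  have h1 : ((gibbsPM G β Λ σ {η | η x = σ x}ᶜ : NNReal) : ENNReal) =
      ((∑ τ ∈ B, (gibbsProb G β Λ σ τ).toNNReal : NNReal) : ENNReal) := by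
    rw [ProbabilityMeasure.ennreal_coeFn_eq_coeFn_toMeasure]
    change gibbsKernel G β Λ σ _ = _
    rw [gibbsKernel_apply _ _ _ _
      (isClopen_setOf_apply_eq x (σ x)).compl.isOpen.measurableSet, Finset.sum_filter]
    push_cast
    refine Finset.sum_congr rfl fun τ _ => ?_
    by_cases h : glue Λ τ σ x = σ x <;> simp [h]
  have hmem : ∀ τ ∈ B, x ∈ disagreement Λ σ τ := by
    intro τ hτ
    have h2 := (Finset.mem_filter.1 hτ).2
    refine Finset.mem_filter.2 ⟨?_, h2⟩
    by_contra hx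
    exact h2 (glue_of_notMem hx _ _)
  have h2 : ∑ τ ∈ B, Real.exp (-β * energy G Λ (glue Λ τ σ)) ≤
      ∑ A ∈ connSets G Λ x, Real.exp (-2 * β * κ) ^ A.card * partitionFn G β Λ σ := by
    have h3 : ∀ τ ∈ B, component G (disagreement Λ σ τ) x ∈ connSets G Λ x := fun τ hτ =>
      mem_connSets.2 ⟨(component_subset _ _).trans (Finset.filter_subset _ _),
        isConnSet_component (hmem τ hτ)⟩
    rw [← Finset.sum_fiberwise_of_maps_to h3]
    refine Finset.sum_le_sum fun A hA => sum_exp_le_of_component hσ hβ hA _ fun τ hτ => ?_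
    rw [Finset.mem_filter] at hτ
    exact ⟨hmem τ hτ.1, hτ.2⟩
  have h3 : ∀ A ∈ connSets G Λ x, Real.exp (-2 * β * κ) ^ A.card ≤
      ε * ((1 : ℝ) / 2 ^ (d + 1)) ^ A.card := by
    intro A hA
    refine (pow_le_pow_left₀ (Real.exp_pos _).le hβε _).trans ?_
    rw [mul_pow]
    refine mul_le_mul_of_nonneg_right ?_ (by positivity)
    refine (pow_le_pow_of_le_one ε.2 (by exact_mod_cast hε)
      (Finset.card_pos.2 ⟨x, (mem_connSets.1 hA).2.1⟩)).trans_eq (pow_one _)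
  have h4 : ∑ τ ∈ B, gibbsProb G β Λ σ τ ≤ ε := by
    unfold gibbsProb
    rw [← Finset.sum_div, div_le_iff₀ (partitionFn_pos G β Λ σ)]
    refine h2.trans ?_
    rw [← Finset.sum_mul]
    refine mul_le_mul_of_nonneg_right ((Finset.sum_le_sum h3).trans ?_)
      (partitionFn_pos G β Λ σ).le
    rw [← Finset.mul_sum]
    exact mul_le_of_le_one_right ε.2 (sum_connSets_le hd Λ x)
  rw [ENNReal.coe_inj.1 h1, ← Real.toNNReal_sum_of_nonneg fun τ _ => gibbsProb_nonneg G β Λ σ τ]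
  exact Real.toNNReal_le_iff_le_coe.2 h4

end Peierls

/-! ### Stability -/

section Stability

/-- By the portmanteau theorem it suffices to bound open sets from below. An open set containing `σ`
contains a cylinder on finitely many sites, and a union bound over these sites applies. -/
theorem tendsto_diracProba [Countable V] {ι : Type*} {L : Filter ι} [L.IsCountablyGenerated]
    {σ : V → Spin} {μ : ι → ProbabilityMeasure (V → Spin)}
    (h : ∀ x, Tendsto (fun i => μ i {η | η x = σ x}ᶜ) L (𝓝 0)) :
    Tendsto μ L (𝓝 (diracProba σ)) := by
  rcases L.eq_or_neBot with rfl | hL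
  · exact tendsto_bot
  refine tendsto_of_forall_isOpen_le_liminf fun U hU => ?_
  by_cases hσ : σ ∈ U
  · obtain ⟨I, u, hu, hI⟩ := isOpen_pi_iff.1 hU σ hσ
    have h1 : ∀ i, 1 - ∑ x ∈ I, μ i {η | η x = σ x}ᶜ ≤ μ i U := by
      intro i
      rw [tsub_le_iff_right]
      have h2 : Set.univ ⊆ U ∪ ⋃ x ∈ I, {η | η x = σ x}ᶜ := by
        intro η _
        by_cases hη : ∀ x ∈ I, η x = σ x
        · exact Or.inl (hI fun x hx => by rw [hη x hx]; exact (hu x hx).2)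
        · push Not at hη
          obtain ⟨x, hx, hne⟩ := hη
          exact Or.inr (Set.mem_biUnion hx hne)
      have h3 := measure_mono (μ := (μ i : Measure (V → Spin))) h2
      have h4 : (μ i : Measure (V → Spin)) (⋃ x ∈ I, {η | η x = σ x}ᶜ) ≤
          ∑ x ∈ I, (μ i : Measure (V → Spin)) {η | η x = σ x}ᶜ := measure_biUnion_finset_le _ _
      have h5 := h3.trans ((measure_union_le _ _).trans (add_le_add_right h4 _))
      simp only [← ProbabilityMeasure.ennreal_coeFn_eq_coeFn_toMeasure,
        ProbabilityMeasure.coeFn_univ] at h5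
      exact_mod_cast h5
    have h2 : Tendsto (fun i => 1 - ∑ x ∈ I, μ i {η | η x = σ x}ᶜ) L (𝓝 1) := by
      have h3 := (tendsto_const_nhds (x := (1 : NNReal))).sub (tendsto_finsetSum I fun x _ => h x)
      simpa using h3
    have h3 : Tendsto (fun i => μ i U) L (𝓝 1) :=
      tendsto_of_tendsto_of_tendsto_of_le_of_le h2 tendsto_const_nhds h1
        fun i => ProbabilityMeasure.apply_le_one _ _
    rw [h3.liminf_eq]
    exact ProbabilityMeasure.apply_le_one _ _
  · have : diracProba σ U = 0 := by
      rw [← ENNReal.coe_inj, ProbabilityMeasure.ennreal_coeFn_eq_coeFn_toMeasure]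
      change Measure.dirac σ U = _
      rw [Measure.dirac_apply' _ hU.measurableSet]
      simp [hσ]
    rw [this]
    exact zero_le

variable [Countable V] [DecidableEq V] {G : SimpleGraph V} [G.LocallyFinite]

theorem PeierlsCondition.isStable {d : ℕ} (hd : G.IsRegularOfDegree d) {σ : V → Spin} {κ : ℝ}
    (hκ : 0 < κ) (hσ : PeierlsCondition G σ κ) : IsStable G σ := by
  let ε : ℝ → ℝ := fun β => 2 ^ (d + 1) * Real.exp (-2 * β * κ)
  have hε : Tendsto ε atTop (𝓝 0) := by
    have h1 : Tendsto (fun β : ℝ => -2 * β * κ) atTop atBot := by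
      have : (fun β : ℝ => -2 * β * κ) = fun β => β * (-2 * κ) := by
        funext β
        ring
      rw [this]
      exact tendsto_id.atTop_mul_const_of_neg (by linarith)
    have h2 := (Real.tendsto_exp_atBot.comp h1).const_mul ((2 : ℝ) ^ (d + 1))
    rwa [mul_zero] at h2
  obtain ⟨β₀, h0⟩ := eventually_atTop.1
    ((hε.eventually (ge_mem_nhds zero_lt_one)).and (eventually_ge_atTop 0))
  have key : ∀ β ≥ β₀, ∃ μ : ProbabilityMeasure (V → Spin), IsGibbsState G β μ ∧
      ∀ x, μ {η | η x = σ x}ᶜ ≤ (ε β).toNNReal := by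
    intro β hβ
    refine exists_isGibbsState G β σ fun Λ x => gibbsPM_compl_le hd hσ (h0 β hβ).2
      (Real.toNNReal_le_one.2 (h0 β hβ).1) ?_ Λ x
    rw [Real.coe_toNNReal _ (by positivity)]
    simp only [ε]
    field_simp
    exact le_rfl
  classical
  refine ⟨β₀, fun β => if h : β ≥ β₀ then (key β h).choose else diracProba σ, ?_, ?_⟩
  · intro β hβ
    simp only [dif_pos hβ]
    exact (key β hβ).choose_spec.1
  · refine tendsto_diracProba fun x => ?_
    have h2 : Tendsto (fun β => (ε β).toNNReal) atTop (𝓝 0) := by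
      have h3 := (continuous_real_toNNReal.tendsto 0).comp hε
      rwa [Real.toNNReal_zero] at h3
    refine tendsto_of_tendsto_of_tendsto_of_le_of_le' tendsto_const_nhds h2
      (Eventually.of_forall fun _ => zero_le) ?_
    filter_upwards [eventually_ge_atTop β₀] with β hβ
    simp only [dif_pos hβ]
    exact (key β hβ).choose_spec.2 x

/-- A stable configuration is a ground state. -/
theorem IsStable.isGroundState {σ : V → Spin} (hσ : IsStable G σ) : IsGroundState G σ := by
  obtain ⟨β₀, μ, hμ, hlim⟩ := hσ
  intro Λ τ hτ
  by_contra hE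
  push Not at hE
  -- `Γ` adds to `Λ` its neighbours, so the cylinder event `C ρ` fixes every spin that enters the
  -- energy in `Λ`.
  let Γ : Finset V := Λ ∪ Λ.biUnion fun x => G.neighborFinset x
  let C : (V → Spin) → Set (V → Spin) := fun ρ => {η | ∀ x ∈ Γ, η x = ρ x}
  have hC : ∀ ρ, IsClopen (C ρ) := by
    intro ρ
    have : C ρ = ⋂ x ∈ Γ, {η : V → Spin | η x = ρ x} := by
      ext η
      simp [C]
    rw [this]
    exact Γ.finite_toSet.isClopen_biInter fun x _ => isClopen_setOf_apply_eq x (ρ x)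
  -- If the boundary condition agrees with `σ` on `Γ \ Λ`, both events are single configurations in
  -- `Λ` and the one of lower energy is likelier; otherwise `C σ` has probability zero.
  have hkernel : ∀ β ≥ 0, ∀ η, gibbsKernel G β Λ η (C σ) ≤ gibbsKernel G β Λ η (C τ) := by
    intro β hβ η
    by_cases hη : ∀ x ∈ Γ, x ∉ Λ → η x = σ x
    · have hin : ∀ ρ : V → Spin, (∀ x ∉ Λ, ρ x = σ x) → ∀ τ' : Λ → Spin,
          glue Λ τ' η ∈ C ρ ↔ τ' = fun x : Λ => ρ x := by
        intro ρ hρ τ'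
        constructor
        · intro h
          funext x
          rw [← h x (Finset.mem_union_left _ x.2), glue_of_mem x.2]
        · rintro rfl x hx
          by_cases hxΛ : x ∈ Λ
          · rw [glue_of_mem hxΛ]
          · rw [glue_of_notMem hxΛ, hη x hx hxΛ, hρ x hxΛ]
      have hval : ∀ ρ : V → Spin, (∀ x ∉ Λ, ρ x = σ x) → gibbsKernel G β Λ η (C ρ) =
          ((gibbsProb G β Λ η fun x : Λ => ρ x).toNNReal : ENNReal) := by
        intro ρ hρ
        rw [gibbsKernel_apply _ _ _ _ (hC ρ).isOpen.measurableSet,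
          Finset.sum_eq_single fun x : Λ => ρ x]
        · rw [Set.indicator_of_mem ((hin ρ hρ _).2 rfl), Pi.one_apply, mul_one]
        · intro τ' _ hne
          rw [Set.indicator_of_notMem fun h => hne ((hin ρ hρ _).1 h), mul_zero]
        · intro h
          exact absurd (Finset.mem_univ _) h
      have hen : ∀ ρ : V → Spin, (∀ x ∉ Λ, ρ x = σ x) →
          energy G Λ (glue Λ (fun x : Λ => ρ x) η) = energy G Λ ρ := by
        intro ρ hρ
        have h1 := (hin ρ hρ _).2 rfl
        exact energy_congr fun x y hx hxy => ⟨h1 x (Finset.mem_union_left _ hx),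
          h1 y (Finset.mem_union_right _ (Finset.mem_biUnion.2 ⟨x, hx, by simpa using hxy⟩))⟩
      rw [hval σ fun _ _ => rfl, hval τ hτ, ENNReal.coe_le_coe]
      refine Real.toNNReal_le_toNNReal ?_
      unfold gibbsProb
      rw [hen σ fun _ _ => rfl, hen τ hτ]
      refine div_le_div_of_nonneg_right (Real.exp_le_exp.2 ?_) (partitionFn_pos G β Λ η).le
      have := mul_le_mul_of_nonneg_left hE.le hβ
      linarith
    · push Not at hη
      obtain ⟨x, hx, hxΛ, hne⟩ := hη
      rw [gibbsKernel_apply _ _ _ _ (hC σ).isOpen.measurableSet, Finset.sum_eq_zero]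
      · exact zero_le
      · intro τ' _
        rw [Set.indicator_of_notMem, mul_zero]
        intro h
        have := h x hx
        rw [glue_of_notMem hxΛ] at this
        exact hne this
  have hdisj : Disjoint (C σ) (C τ) := by
    rw [Set.disjoint_left]
    intro η h1 h2
    have : energy G Λ σ = energy G Λ τ := by
      have h3 : ∀ x ∈ Γ, σ x = τ x := fun x hx => (h1 x hx).symm.trans (h2 x hx)
      exact energy_congr fun x y hx hxy => ⟨h3 x (Finset.mem_union_left _ hx),
        h3 y (Finset.mem_union_right _ (Finset.mem_biUnion.2 ⟨x, hx, by simpa using hxy⟩))⟩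
    exact hE.ne' this
  -- By the DLR equations `C σ` is at most as likely as the disjoint event `C τ`, hence has
  -- probability at most one half. Weak convergence to `σ` would make it tend to one.
  have hhalf : ∀ β ≥ max β₀ 0, μ β (C σ) + μ β (C σ) ≤ 1 := by
    intro β hβ
    have hG := hμ β ((le_max_left _ _).trans hβ)
    have h1 : (μ β : Measure (V → Spin)) (C σ) ≤ (μ β : Measure (V → Spin)) (C τ) := by
      rw [← hG Λ _ (hC σ).isOpen.measurableSet, ← hG Λ _ (hC τ).isOpen.measurableSet]
      exact lintegral_mono (hkernel β ((le_max_right _ _).trans hβ))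
    have h2 : (μ β : Measure (V → Spin)) (C σ) + (μ β : Measure (V → Spin)) (C σ) ≤ 1 := by
      refine (add_le_add_right h1 _).trans ?_
      rw [← measure_union hdisj (hC τ).isOpen.measurableSet]
      exact prob_le_one
    simp only [← ProbabilityMeasure.ennreal_coeFn_eq_coeFn_toMeasure] at h2
    exact_mod_cast h2
  have hto : Tendsto (fun β => μ β (C σ)) atTop (𝓝 1) := by
    have h1 := ProbabilityMeasure.tendsto_measure_of_null_frontier_of_tendsto hlim
      (E := C σ) (by
        rw [(hC σ).frontier_eq]
        simp)
    have h2 : diracProba σ (C σ) = 1 := by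
      rw [← ENNReal.coe_inj, ProbabilityMeasure.ennreal_coeFn_eq_coeFn_toMeasure]
      change Measure.dirac σ (C σ) = _
      rw [Measure.dirac_apply' _ (hC σ).isOpen.measurableSet]
      simp [C]
    rwa [h2] at h1
  have h1 := le_of_tendsto (hto.add hto)
    ((eventually_ge_atTop (max β₀ 0)).mono fun β hβ => hhalf β hβ)
  norm_num at h1

end Stability


/-! ### Chains with two vertices on the tree with three neighbours -/

section OneChains

variable {G : SimpleGraph V}

theorem IsCovering.exists_adj_mem_dimers {R : Set (Fin (1 + 1) → V)} (hR : IsCovering G R)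
    (J : (Fin (1 + 1) → V) → Fin 1) (x : V) : ∃ y, G.Adj x y ∧ s(x, y) ∈ dimers R J := by
  obtain ⟨c, ⟨hc, i, rfl⟩, -⟩ := hR.existsUnique x
  have h := (hR.chain c hc).adj (J c)
  rcases Fin.eq_castSucc_or_eq_last i with ⟨j, rfl⟩ | rfl
  · obtain rfl := Subsingleton.elim (J c) j
    exact ⟨_, h, mem_dimers.2 ⟨c, hc, Or.inl ⟨rfl, rfl⟩⟩⟩
  · have h1 : Fin.last 1 = (J c).succ := by
      rw [Subsingleton.elim (J c) 0]
      rfl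
    rw [h1]
    exact ⟨_, h.symm, mem_dimers.2 ⟨c, hc, Or.inr ⟨rfl, rfl⟩⟩⟩

variable [DecidableEq V] [G.LocallyFinite]

/-- Take a vertex `y` with its two neighbours `x`, `z` not joined to it by a dimer. The set `{x, y,
z}` has at most five boundary bonds, and each of its vertices sends its dimer outside; reversing it
changes the energy by at most `2 (5 - 2 * 3) < 0`. -/
theorem IsCovering.not_isGroundState (hG : G.IsTree) (hd : G.IsRegularOfDegree 3)
    {R : Set (Fin (1 + 1) → V)} (hR : IsCovering G R) {J : (Fin (1 + 1) → V) → Fin 1}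
    {σ : V → Spin} (hσ : IsDimerConfig G (dimers R J) σ) : ¬ IsGroundState G σ := by
  classical
  obtain ⟨y⟩ := hG.connected.nonempty
  obtain ⟨w, hyw, hw⟩ := hR.exists_adj_mem_dimers J y
  have hcard : ∀ v, (G.neighborFinset v).card = 3 := fun v => by
    rw [G.card_neighborFinset_eq_degree, hd v]
  have hwy : w ∈ G.neighborFinset y := by simpa using hyw
  have h2 : ((G.neighborFinset y).erase w).card = 2 := by
    rw [Finset.card_erase_of_mem hwy, hcard]
  obtain ⟨x, z, hxz, hN⟩ := Finset.card_eq_two.1 h2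
  have hx : x ∈ (G.neighborFinset y).erase w := by simp [hN]
  have hz : z ∈ (G.neighborFinset y).erase w := by simp [hN]
  rw [Finset.mem_erase, SimpleGraph.mem_neighborFinset] at hx hz
  have hxD : s(y, x) ∉ dimers R J := fun h => hx.1 (eq_of_mem_dimers hR h hw)
  have hzD : s(y, z) ∉ dimers R J := fun h => hz.1 (eq_of_mem_dimers hR h hw)
  have hnadj : ¬ G.Adj x z := fun h => hG.dist_ne_of_adj y h (by
    rw [SimpleGraph.dist_eq_one_iff_adj.2 hx.2, SimpleGraph.dist_eq_one_iff_adj.2 hz.2])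
  let A : Finset V := {x, y, z}
  have hout : ∀ v ∈ A, 1 ≤ ((G.neighborFinset v \ A).filter fun u => s(v, u) ∈ dimers R J).card := by
    intro v hv
    obtain ⟨u, hvu, hu⟩ := hR.exists_adj_mem_dimers J v
    refine Finset.card_pos.2 ⟨u, Finset.mem_filter.2 ⟨Finset.mem_sdiff.2 ⟨by simpa using hvu, ?_⟩, hu⟩⟩
    intro huA
    simp only [A, Finset.mem_insert, Finset.mem_singleton] at hv huA
    rcases hv with rfl | rfl | rfl <;> rcases huA with rfl | rfl | rfl
    · exact hvu.ne rfl
    · exact hxD (Sym2.eq_swap ▸ hu)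
    · exact hnadj hvu
    · exact hxD hu
    · exact hvu.ne rfl
    · exact hzD hu
    · exact hnadj hvu.symm
    · exact hzD (Sym2.eq_swap ▸ hu)
    · exact hvu.ne rfl
  have hends : ∀ v ∈ A, G.Adj y v → (G.neighborFinset v \ A).card ≤ 2 := by
    intro v _ hyv
    have h3 : G.neighborFinset v \ A ⊆ (G.neighborFinset v).erase y := by
      intro u hu
      rw [Finset.mem_sdiff] at hu
      refine Finset.mem_erase.2 ⟨?_, hu.1⟩
      rintro rfl
      exact hu.2 (by simp [A])
    refine (Finset.card_le_card h3).trans ?_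
    rw [Finset.card_erase_of_mem (by simpa using hyv.symm), hcard]
  have hmid : (G.neighborFinset y \ A).card ≤ 1 := by
    have h3 : G.neighborFinset y \ A ⊆ {w} := by
      intro u hu
      rw [Finset.mem_sdiff] at hu
      by_contra hcon
      have h4 : u ∈ (G.neighborFinset y).erase w :=
        Finset.mem_erase.2 ⟨fun h => hcon (Finset.mem_singleton.2 h), hu.1⟩
      rw [hN] at h4
      refine hu.2 ?_
      simp only [A, Finset.mem_insert, Finset.mem_singleton] at h4 ⊢
      tauto
    exact (Finset.card_le_card h3).trans_eq (Finset.card_singleton w)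
  have hA : ∀ g : V → ℕ, ∑ v ∈ A, g v = g x + (g y + g z) := by
    intro g
    rw [Finset.sum_insert, Finset.sum_insert, Finset.sum_singleton]
    · simpa using hz.2.ne
    · simpa using ⟨hx.2.ne', hxz⟩
  have h3 := hσ.sum_boundary A
  have h4 : ∑ v ∈ A, (G.neighborFinset v \ A).card ≤ 5 := by
    rw [hA]
    have := hends x (by simp [A]) hx.2
    have := hends z (by simp [A]) hz.2
    omega
  have h5 : 3 ≤ ∑ v ∈ A, ((G.neighborFinset v \ A).filter fun u => s(v, u) ∈ dimers R J).card := by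
    rw [hA]
    have := hout x (by simp [A])
    have := hout y (by simp [A])
    have := hout z (by simp [A])
    omega
  have h4' : ((∑ v ∈ A, (G.neighborFinset v \ A).card : ℕ) : ℝ) ≤ 5 := by exact_mod_cast h4
  have h5' : (3 : ℝ) ≤ ((∑ v ∈ A, ((G.neighborFinset v \ A).filter
    fun u => s(v, u) ∈ dimers R J).card : ℕ) : ℝ) := by exact_mod_cast h5
  intro hground
  have h6 := hground A (flip A σ) fun v hv => if_neg hv
  have h7 := energy_flip_sub (G := G) A σ
  linarith

end OneChains

/-! ### Existence of rooted coverings -/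

section RootedCoverings

variable {G : SimpleGraph V} [G.LocallyFinite]

theorem exists_adj_farther (hG : G.IsTree) (o : V) {x : V} (hx : 2 ≤ G.degree x) :
    ∃ y, G.Adj x y ∧ G.dist o y = G.dist o x + 1 := by
  by_contra hcon
  push Not at hcon
  have h : (G.neighborFinset x).card ≤ 1 := by
    refine Finset.card_le_one.2 fun y hy z hz => ?_
    rw [SimpleGraph.mem_neighborFinset] at hy hz
    exact eq_of_adj_of_closer hG hy hz
      ((hG.dist_eq_dist_add_one_of_adj o hy).resolve_right (hcon y hy))
      ((hG.dist_eq_dist_add_one_of_adj o hz).resolve_right (hcon z hz))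
  rw [G.card_neighborFinset_eq_degree] at h
  omega

open Classical in
/-- The number of consecutive steps from `x` towards the root along bonds `(y, f y)`, when `x` is
at distance `r` from the root. -/
noncomputable def runLength (G : SimpleGraph V) (o : V) (f : V → V) : ℕ → V → ℕ
  | 0, _ => 0
  | r + 1, x => if x = f (parent G o x) then runLength G o f r (parent G o x) + 1 else 0

/-- Choose one child `f x` of every vertex. Since `parent` is a left inverse, `f` is injective and
its orbits split the tree into disjoint rays going away from the root; each ray is cut into
consecutive segments of `k + 1` vertices. The position `t x` on the ray tells where to cut. -/
theorem exists_isRootedCovering (hG : G.IsTree) (hd : ∀ x, 2 ≤ G.degree x) (o : V) (k : ℕ) :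
    ∃ R : Set (Fin (k + 1) → V), IsRootedCovering G o R := by
  choose f hfadj hfdist using fun x => exists_adj_farther hG o (hd x)
  have hpf : ∀ x, parent G o (f x) = x := fun x =>
    (eq_parent hG (hfadj x).symm (hfdist x)).symm
  have hinj : Function.Injective f := Function.LeftInverse.injective hpf
  let t : V → ℕ := fun x => runLength G o f (G.dist o x) x
  have htf : ∀ x, t (f x) = t x + 1 := by
    intro x
    simp only [t]
    rw [hfdist, runLength, hpf, if_pos rfl]
  have htpos : ∀ x, 0 < t x → ∃ y, f y = x ∧ t y + 1 = t x := by
    intro x hx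
    refine ⟨parent G o x, ?_⟩
    have h : x = f (parent G o x) := by
      by_contra hcon
      rcases hr : G.dist o x with _ | r
      · simp [t, hr, runLength] at hx
      · simp [t, hr, runLength, hcon] at hx
    exact ⟨h.symm, by rw [← htf, ← h]⟩
  have hti : ∀ (i : ℕ) x, t (f^[i] x) = t x + i := by
    intro i x
    induction i with
    | zero => rfl
    | succ i ih => rw [Function.iterate_succ_apply', htf, ih, add_assoc]
  have hdi : ∀ (i : ℕ) x, G.dist o (f^[i] x) = G.dist o x + i := by
    intro i x
    induction i with
    | zero => rfl
    | succ i ih => rw [Function.iterate_succ_apply', hfdist, ih, add_assoc]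
  have hback : ∀ i x, i ≤ t x → ∃ y, f^[i] y = x ∧ t y + i = t x := by
    intro i
    induction i with
    | zero => exact fun x _ => ⟨x, rfl, rfl⟩
    | succ i ih =>
      intro x hx
      obtain ⟨y, hy, hty⟩ := htpos x (by omega)
      obtain ⟨z, hz, htz⟩ := ih y (by omega)
      exact ⟨z, by rw [Function.iterate_succ_apply', hz, hy], by omega⟩
  -- Chains start at the positions divisible by `k + 1`.
  refine ⟨{c | ∃ x, t x % (k + 1) = 0 ∧ ∀ i, c i = f^[(i : ℕ)] x}, ⟨⟨?_, ?_⟩, ?_⟩⟩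
  · rintro c ⟨x, -, hc⟩
    refine ⟨fun i j hij => ?_, fun j => ?_⟩
    · rw [hc, hc] at hij
      have h1 := congrArg t hij
      rw [hti, hti] at h1
      exact Fin.ext (by omega)
    · rw [hc, hc, Fin.val_succ, Fin.val_castSucc, Function.iterate_succ_apply']
      exact hfadj _
  · intro x
    obtain ⟨y, hy, hty⟩ := hback (t x % (k + 1)) x (Nat.mod_le _ _)
    have hlt : t x % (k + 1) < k + 1 := Nat.mod_lt _ (Nat.succ_pos k)
    refine ⟨fun i => f^[(i : ℕ)] y, ⟨⟨y, ?_, fun _ => rfl⟩, ⟨⟨_, hlt⟩, hy⟩⟩, ?_⟩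
    · have h1 : t y = t x - t x % (k + 1) := by omega
      rw [h1]
      exact Nat.mod_eq_zero_of_dvd (Nat.dvd_sub_mod _)
    · rintro c ⟨⟨z, hz, hc⟩, i, hi⟩
      rw [hc] at hi
      have h1 := congrArg t hi
      rw [hti] at h1
      have h2 : t x % (k + 1) = i := by
        rw [← h1, Nat.add_mod, hz, zero_add, Nat.mod_mod, Nat.mod_eq_of_lt i.2]
      have h3 : z = y := hinj.iterate i (by rw [hi, ← h2, hy])
      funext j
      rw [hc, h3]
  · rintro c ⟨x, -, hc⟩ i
    rw [hc, hc, hdi, Fin.val_zero]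
    rfl

end RootedCoverings


/-! ### The Markov chain of positions along the chains

The state `(s, i)` stands for a vertex with index `i` in a chain whose first spin is `s`. -/

section Markov

/-- The spin at index `i` of a chain with first spin `s`, whose spins change after `L s` sites. -/
def chainSpin (L : Spin → ℕ) (s : Spin) (i : ℕ) : Spin :=
  if i < L s then s else -s

/-- The average of `spinVal` over the descendants at depth `r` of a vertex in state `(s, i)`. -/
noncomputable def meanSpin (k : ℕ) (L : Spin → ℕ) : ℕ → Spin → ℕ → ℝ
  | 0, s, i => spinVal (chainSpin L s i)
  | r + 1, s, i =>
    if i < k then (meanSpin k L r s (i + 1) + meanSpin k L r (chainSpin L s i) 0) / 2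
    else meanSpin k L r (chainSpin L s i) 0

variable {k : ℕ} {L : Spin → ℕ}

/-- The backward equation of the Markov chain. -/
def IsBackward (k : ℕ) (L : Spin → ℕ) (u : ℕ → Spin → ℕ → ℝ) : Prop :=
  ∀ r s i, u (r + 1) s i = if i < k then (u r s (i + 1) + u r (chainSpin L s i) 0) / 2
    else u r (chainSpin L s i) 0

theorem isBackward_meanSpin : IsBackward k L (meanSpin k L) := fun _ _ _ => rfl

theorem IsBackward.neg {u : ℕ → Spin → ℕ → ℝ} (hu : IsBackward k L u) :
    IsBackward k L fun r s i => -u r s i := by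
  intro r s i
  simp only [hu r s i]
  split_ifs <;> ring

theorem IsBackward.le_succ {u : ℕ → Spin → ℕ → ℝ} (hu : IsBackward k L u) {r : ℕ} {a : ℝ}
    (h : ∀ s, ∀ i ≤ k, a ≤ u r s i) : ∀ s, ∀ i ≤ k, a ≤ u (r + 1) s i := by
  intro s i hi
  rw [hu]
  have h1 := h (chainSpin L s i) 0 (Nat.zero_le _)
  split_ifs with hik
  · have := h s (i + 1) hik
    linarith
  · exact h1

theorem IsBackward.le_add {u : ℕ → Spin → ℕ → ℝ} (hu : IsBackward k L u) {r : ℕ} {a : ℝ}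
    (h : ∀ s, ∀ i ≤ k, a ≤ u r s i) (j : ℕ) : ∀ s, ∀ i ≤ k, a ≤ u (r + j) s i := by
  induction j with
  | zero => exact h
  | succ j ih => exact hu.le_succ ih

/-- One step reaches any of its two possible targets with probability at least one half. -/
theorem IsBackward.half_le {u : ℕ → Spin → ℕ → ℝ} (hu : IsBackward k L u) {r : ℕ} {a b : ℝ}
    (h : ∀ s, ∀ i ≤ k, a ≤ u r s i) {s : Spin} {i : ℕ}
    (hb : (i < k ∧ a + b ≤ u r s (i + 1)) ∨ a + b ≤ u r (chainSpin L s i) 0) :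
    a + b / 2 ≤ u (r + 1) s i := by
  rw [hu]
  have h1 := h (chainSpin L s i) 0 (Nat.zero_le _)
  split_ifs with hik
  · have h2 := h s (i + 1) hik
    rcases hb with hb | hb
    · linarith [hb.2]
    · linarith
  · rcases hb with hb | hb
    · exact absurd hb.1 hik
    · linarith

/-- Doeblin's lower bound: from every state, `(+, 0)` is reached in `k + 2` steps. -/
theorem IsBackward.doeblin {u : ℕ → Spin → ℕ → ℝ} (hu : IsBackward k L u) (hL1 : 0 < L 1)
    (hLk : L (-1) ≤ k) {r : ℕ} {a : ℝ} (h : ∀ s, ∀ i ≤ k, a ≤ u r s i) :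
    ∀ s, ∀ i ≤ k, a + (u r 1 0 - a) / 2 ^ (k + 2) ≤ u (r + (k + 2)) s i := by
  have hstep : ∀ j : ℕ, (u r 1 0 - a) / 2 ^ (j + 1) = (u r 1 0 - a) / 2 ^ j / 2 := fun j => by
    rw [pow_succ, div_div]
  have h1 : ∀ j, a + (u r 1 0 - a) / 2 ^ j ≤ u (r + j) 1 0 := by
    intro j
    induction j with
    | zero => simp
    | succ j ih =>
      rw [hstep, ← add_assoc]
      refine hu.half_le (hu.le_add h j) (Or.inr ?_)
      rwa [chainSpin, if_pos hL1]
  have h2 : ∀ d i, i + d = k → ∀ j, d + 1 ≤ j → a + (u r 1 0 - a) / 2 ^ j ≤ u (r + j) (-1) i := by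
    intro d
    induction d with
    | zero =>
      intro i hi j hj
      obtain ⟨j, rfl⟩ := Nat.exists_eq_add_of_le' hj
      rw [zero_add, hstep, ← add_assoc]
      refine hu.half_le (hu.le_add h j) (Or.inr ?_)
      rw [chainSpin, if_neg (by omega), neg_neg]
      exact h1 j
    | succ d ih =>
      intro i hi j hj
      obtain ⟨j, rfl⟩ : ∃ j', j = j' + 1 := ⟨j - 1, by omega⟩
      rw [hstep, ← add_assoc]
      exact hu.half_le (hu.le_add h j) (Or.inl ⟨by omega, ih (i + 1) (by omega) j (by omega)⟩)
       
  intro s i hi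
  rw [hstep, ← add_assoc]
  refine hu.half_le (hu.le_add h (k + 1)) (Or.inr ?_)
  rcases Int.units_eq_one_or (chainSpin L s i) with hs | hs
  · rw [hs]
    exact h1 _
  · rw [hs]
    exact h2 k 0 (zero_add k) _ le_rfl

theorem abs_spinVal (s : Spin) : |spinVal s| = 1 := by
  rcases Int.units_eq_one_or s with rfl | rfl <;> simp [spinVal]

/-- Doeblin's bound, applied to the mean spin and to its negative, pulls the lower and upper bounds
towards the same value `c`, shrinking their gap by the factor `1 - 2 ^ -(k + 2)`. -/
theorem meanSpin_contraction (hL1 : 0 < L 1) (hLk : L (-1) ≤ k) (q : ℕ) :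
    ∃ a b : ℝ, (∀ s, ∀ i ≤ k, a ≤ meanSpin k L (q * (k + 2)) s i ∧
      meanSpin k L (q * (k + 2)) s i ≤ b) ∧ b - a = 2 * (1 - 1 / 2 ^ (k + 2)) ^ q := by
  induction q with
  | zero =>
    refine ⟨-1, 1, fun s i _ => ?_, by norm_num⟩
    rw [zero_mul, meanSpin]
    exact abs_le.1 (abs_spinVal _).le
  | succ q ih =>
    obtain ⟨a, b, h, hab⟩ := ih
    let u := meanSpin k L
    let c := u (q * (k + 2)) 1 0
    refine ⟨a + (c - a) / 2 ^ (k + 2), b - (b - c) / 2 ^ (k + 2), fun s i hi => ?_, ?_⟩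
    · have h1 := (isBackward_meanSpin (k := k) (L := L)).doeblin hL1 hLk
        (fun s i hi => (h s i hi).1) s i hi
      have h2 := (isBackward_meanSpin (k := k) (L := L)).neg.doeblin hL1 hLk (a := -b)
        (fun s i hi => neg_le_neg (h s i hi).2) s i hi
      rw [add_mul, one_mul]
      refine ⟨h1, ?_⟩
      have h3 : -b + (-meanSpin k L (q * (k + 2)) 1 0 - -b) / 2 ^ (k + 2) =
          -(b - (b - c) / 2 ^ (k + 2)) := by
        simp only [c, u]
        ring
      rw [h3] at h2
      exact neg_le_neg_iff.1 h2
    · rw [pow_succ _ q, ← mul_assoc, ← hab]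
      ring

/-- The invariant functional of the Markov chain. -/
noncomputable def invariantSum (k : ℕ) (L : Spin → ℕ) (w : Spin → ℕ → ℝ) : ℝ :=
  (1 / 2) ^ L (-1) * ∑ i ∈ Finset.range (k + 1), (1 / 2) ^ i * w 1 i +
    (1 / 2) ^ L 1 * ∑ i ∈ Finset.range (k + 1), (1 / 2) ^ i * w (-1) i

/-- With weights `2 ^ -i` along a chain, mass `2 ^ -(i + 1)` starts new chains from index `i < k`
and the remaining `2 ^ -k` does so from index `k`. The share of new chains that start with the
opposite spin is thus `2 ^ -l`. -/
theorem sum_geometric_split (x y : ℝ) {l k : ℕ} (h : l ≤ k) :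
    ∑ i ∈ Finset.range k, (1 / 2 : ℝ) ^ (i + 1) * (if i < l then x else y) + (1 / 2) ^ k * y =
      (1 - (1 / 2) ^ l) * x + (1 / 2) ^ l * y := by
  induction k, h using Nat.le_induction with
  | base =>
    rw [Finset.sum_congr rfl fun i hi => by rw [if_pos (Finset.mem_range.1 hi)],
      ← Finset.sum_mul]
    have : ∑ i ∈ Finset.range l, (1 / 2 : ℝ) ^ (i + 1) = 1 - (1 / 2) ^ l := by
      induction l with
      | zero => simp
      | succ l ih =>
        rw [Finset.sum_range_succ, ih]
        ring
    rw [this]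
  | succ k hk ih =>
    rw [Finset.sum_range_succ, if_neg (by omega), ← ih]
    ring

/-- Chain starts switch from spin `s` to `-s` with probability `2 ^ -(L s)`. The weight `2 ^ -(L
(-s))` given to chains starting with `s` balances the two flows. -/
theorem invariantSum_succ (hL1 : L 1 ≤ k) (hL2 : L (-1) ≤ k) {u : ℕ → Spin → ℕ → ℝ}
    (hu : IsBackward k L u) (r : ℕ) :
    invariantSum k L (u (r + 1)) = invariantSum k L (u r) := by
  have key : ∀ s, L s ≤ k → ∑ i ∈ Finset.range (k + 1), (1 / 2 : ℝ) ^ i * u (r + 1) s i =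
      ∑ i ∈ Finset.range (k + 1), (1 / 2) ^ i * u r s i - u r s 0 +
        ((1 - (1 / 2) ^ L s) * u r s 0 + (1 / 2) ^ L s * u r (-s) 0) := by
    intro s hs
    rw [← sum_geometric_split (u r s 0) (u r (-s) 0) hs, Finset.sum_range_succ,
      Finset.sum_range_succ' _ k]
    have h1 : ∀ i ∈ Finset.range k, (1 / 2 : ℝ) ^ i * u (r + 1) s i =
        (1 / 2) ^ (i + 1) * u r s (i + 1) +
          (1 / 2) ^ (i + 1) * (if i < L s then u r s 0 else u r (-s) 0) := by
      intro i hi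
      rw [hu, if_pos (Finset.mem_range.1 hi), chainSpin]
      split_ifs <;> ring
    rw [Finset.sum_congr rfl h1, Finset.sum_add_distrib, hu r s k, if_neg (lt_irrefl k), chainSpin,
      if_neg (by omega)]
    ring
  unfold invariantSum
  rw [key 1 hL1, key (-1) hL2, neg_neg]
  ring

theorem invariantSum_const (c : ℝ) : invariantSum k L (fun _ _ => c) =
    ((1 / 2) ^ L (-1) + (1 / 2) ^ L 1) * (∑ i ∈ Finset.range (k + 1), (1 / 2) ^ i) * c := by
  unfold invariantSum
  rw [← Finset.sum_mul]
  ring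

theorem invariantSum_mono {w w' : Spin → ℕ → ℝ} (h : ∀ s, ∀ i ≤ k, w s i ≤ w' s i) :
    invariantSum k L w ≤ invariantSum k L w' := by
  unfold invariantSum
  have h1 : ∀ s, ∑ i ∈ Finset.range (k + 1), (1 / 2 : ℝ) ^ i * w s i ≤
      ∑ i ∈ Finset.range (k + 1), (1 / 2) ^ i * w' s i := fun s =>
    Finset.sum_le_sum fun i hi => mul_le_mul_of_nonneg_left
      (h s i (Nat.lt_succ_iff.1 (Finset.mem_range.1 hi))) (by positivity)
  exact add_le_add (mul_le_mul_of_nonneg_left (h1 1) (by positivity))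
    (mul_le_mul_of_nonneg_left (h1 (-1)) (by positivity))

/-- A chain with first spin `s` has weighted spin `2 - 4 * 2 ^ -(L s) + 2 ^ -k` times `s`; the
products of the two exponentials cancel in the difference, leaving a quantity that vanishes only
when `L 1 = L (-1)`. -/
theorem invariantSum_meanSpin_zero (hL1 : L 1 ≤ k) (hL2 : L (-1) ≤ k) :
    invariantSum k L (meanSpin k L 0) =
      ((1 / 2) ^ L (-1) - (1 / 2) ^ L 1) * (2 + (1 / 2) ^ k) := by
  have key : ∀ s, L s ≤ k → ∑ i ∈ Finset.range (k + 1), (1 / 2 : ℝ) ^ i * meanSpin k L 0 s i =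
      (2 - 4 * (1 / 2) ^ L s + (1 / 2) ^ k) * spinVal s := by
    intro s hs
    have h1 := sum_geometric_split (spinVal s) (-spinVal s) (hs.trans (Nat.le_add_right k 1))
    have h2 : ∀ i ∈ Finset.range (k + 1), (1 / 2 : ℝ) ^ i * meanSpin k L 0 s i =
        2 * ((1 / 2 : ℝ) ^ (i + 1) * (if i < L s then spinVal s else -spinVal s)) := by
      intro i _
      rw [meanSpin, chainSpin, apply_ite spinVal, spinVal_neg]
      ring
    rw [Finset.sum_congr rfl h2, ← Finset.mul_sum, eq_sub_of_add_eq h1]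
    ring
  unfold invariantSum
  rw [key 1 hL1, key (-1) hL2]
  have h1 : spinVal 1 = 1 := by simp [spinVal]
  have h2 : spinVal (-1) = -1 := by simp [spinVal]
  rw [h1, h2]
  ring

/-- Convergence to equilibrium, with a non-zero mean spin. -/
theorem exists_tendsto_meanSpin (hlt : L (-1) < L 1) (hLk : L 1 ≤ k) :
    ∃ m : ℝ, m ≠ 0 ∧ ∀ s, ∀ i ≤ k, Tendsto (fun r => meanSpin k L r s i) atTop (𝓝 m) := by
  let Z : ℝ := ((1 / 2) ^ L (-1) + (1 / 2) ^ L 1) * ∑ i ∈ Finset.range (k + 1), (1 / 2) ^ i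
  have hZ : 0 < Z := mul_pos (by positivity)
    (Finset.sum_pos (fun i _ => by positivity) ⟨0, by simp⟩)
  let m : ℝ := invariantSum k L (meanSpin k L 0) / Z
  have hinv : ∀ r, invariantSum k L (meanSpin k L r) = Z * m := by
    intro r
    induction r with
    | zero => exact (mul_div_cancel₀ _ hZ.ne').symm
    | succ r ih => rw [invariantSum_succ hLk (by omega) isBackward_meanSpin, ih]
  refine ⟨m, ?_, fun s i hi => ?_⟩
  · refine div_ne_zero ?_ hZ.ne'
    rw [invariantSum_meanSpin_zero hLk (by omega)]
    have h1 : ((1 : ℝ) / 2) ^ L 1 < (1 / 2) ^ L (-1) :=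
      pow_lt_pow_right_of_lt_one₀ (by norm_num) (by norm_num) hlt
    exact (mul_pos (sub_pos.2 h1) (by positivity)).ne'
  · rw [Metric.tendsto_atTop]
    intro ε hε
    have hlim : Tendsto (fun q : ℕ => 2 * (1 - 1 / 2 ^ (k + 2) : ℝ) ^ q) atTop (𝓝 0) := by
      have h1 : (1 : ℝ) / 2 ^ (k + 2) ≤ 1 :=
        (div_le_one (by positivity)).2 (one_le_pow₀ one_le_two)
      have h2 : (0 : ℝ) < 1 / 2 ^ (k + 2) := by positivity
      simpa using (tendsto_pow_atTop_nhds_zero_of_lt_one (by linarith)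
        (by linarith : (1 - 1 / 2 ^ (k + 2) : ℝ) < 1)).const_mul 2
    obtain ⟨q, hq⟩ := (hlim.eventually (gt_mem_nhds hε)).exists
    obtain ⟨a, b, hab, hba⟩ := meanSpin_contraction (k := k) (L := L) (by omega) (by omega) q
    have hlow : ∀ r ≥ q * (k + 2), ∀ s, ∀ i ≤ k, a ≤ meanSpin k L r s i := by
      intro r hr
      obtain ⟨j, rfl⟩ := Nat.exists_eq_add_of_le hr
      exact isBackward_meanSpin.le_add (fun s i hi => (hab s i hi).1) j
    have hhigh : ∀ r ≥ q * (k + 2), ∀ s, ∀ i ≤ k, meanSpin k L r s i ≤ b := by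
      intro r hr s i hi
      obtain ⟨j, rfl⟩ := Nat.exists_eq_add_of_le hr
      exact neg_le_neg_iff.1 (isBackward_meanSpin.neg.le_add (a := -b)
        (fun s i hi => neg_le_neg (hab s i hi).2) j s i hi)
    refine ⟨q * (k + 2), fun r hr => ?_⟩
    -- The invariant average of the mean spin does not depend on `r`, so `m` lies between any
    -- eventual lower and upper bounds.
    have h1 : a ≤ m := by
      have := invariantSum_mono (L := L) (w := fun _ _ => a) (hlow r hr)
      rw [hinv, invariantSum_const] at this
      exact le_of_mul_le_mul_left this hZ
    have h2 : m ≤ b := by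
      have := invariantSum_mono (L := L) (w' := fun _ _ => b) (hhigh r hr)
      rw [hinv, invariantSum_const] at this
      exact le_of_mul_le_mul_left this hZ
    have h3 := hlow r hr s i hi
    have h4 := hhigh r hr s i hi
    rw [Real.dist_eq, abs_lt]
    constructor <;> linarith

end Markov


/-! ### Branches, spheres and balls -/

section Branches

variable [DecidableEq V] {G : SimpleGraph V} [G.LocallyFinite]

/-- The vertices at distance `r` from `w`, in the branch of `w` seen from its neighbour `v`. -/
def branch (G : SimpleGraph V) [G.LocallyFinite] : ℕ → V → V → Finset V
  | 0, _, w => {w}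
  | r + 1, v, w => ((G.neighborFinset w).erase v).biUnion (branch G r w)

/-- The vertices at distance `r` from `v`. -/
def sphere (G : SimpleGraph V) [G.LocallyFinite] : ℕ → V → Finset V
  | 0, v => {v}
  | r + 1, v => (G.neighborFinset v).biUnion (branch G r v)

theorem mem_branch (hG : G.IsTree) {r : ℕ} {v w y : V} (h : G.Adj v w) :
    y ∈ branch G r v w ↔ G.dist w y = r ∧ G.dist v y = r + 1 := by
  induction r generalizing v w with
  | zero =>
    rw [branch, Finset.mem_singleton, hG.connected.dist_eq_zero_iff]
    constructor
    · rintro rfl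
      exact ⟨rfl, SimpleGraph.dist_eq_one_iff_adj.2 h⟩
    · exact fun h => h.1.symm
  | succ r ih =>
    simp only [branch, Finset.mem_biUnion, Finset.mem_erase, SimpleGraph.mem_neighborFinset]
    constructor
    · rintro ⟨u, ⟨huv, hwu⟩, hu⟩
      rw [ih hwu] at hu
      refine ⟨hu.2, ?_⟩
      rw [SimpleGraph.dist_comm, SimpleGraph.dist_comm (u := w)] at hu
      rw [SimpleGraph.dist_comm]
      rcases hG.dist_eq_dist_add_one_of_adj y h with h1 | h1
      · omega
      · exact absurd (eq_of_adj_of_closer hG (o := y) hwu h.symm (by omega) h1) huv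
    · rintro ⟨h1, h2⟩
      have hwy : w ≠ y := by
        rintro rfl
        simp at h1
      obtain ⟨u, hwu, hu⟩ := exists_adj_closer hG hwy
      rw [SimpleGraph.dist_comm, SimpleGraph.dist_comm (u := y)] at hu
      refine ⟨u, ⟨?_, hwu⟩, (ih hwu).2 ⟨by omega, h1⟩⟩
      rintro rfl
      omega

theorem mem_sphere (hG : G.IsTree) {r : ℕ} {v y : V} : y ∈ sphere G r v ↔ G.dist v y = r := by
  cases r with
  | zero =>
    rw [sphere, Finset.mem_singleton, hG.connected.dist_eq_zero_iff, eq_comm]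
  | succ r =>
    simp only [sphere, Finset.mem_biUnion, SimpleGraph.mem_neighborFinset]
    constructor
    · rintro ⟨w, hvw, hw⟩
      exact ((mem_branch hG hvw).1 hw).2
    · intro h
      have hvy : v ≠ y := by
        rintro rfl
        simp at h
      obtain ⟨w, hvw, hw⟩ := exists_adj_closer hG hvy
      rw [SimpleGraph.dist_comm, SimpleGraph.dist_comm (u := y)] at hw
      exact ⟨w, hvw, (mem_branch hG hvw).2 ⟨by omega, h⟩⟩

theorem pairwiseDisjoint_branch (hG : G.IsTree) (r : ℕ) (v : V) {S : Finset V}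
    (hS : S ⊆ G.neighborFinset v) : (S : Set V).PairwiseDisjoint (branch G r v) := by
  intro w hw u hu hne
  have hvw : G.Adj v w := by simpa using hS hw
  have hvu : G.Adj v u := by simpa using hS hu
  rw [Function.onFun, Finset.disjoint_left]
  intro y h1 h2
  rw [mem_branch hG hvw] at h1
  rw [mem_branch hG hvu] at h2
  refine hne (eq_of_adj_of_closer hG (o := y) hvw hvu ?_ ?_)
  · rw [SimpleGraph.dist_comm, SimpleGraph.dist_comm (u := y), h1.1, h1.2]
  · rw [SimpleGraph.dist_comm, SimpleGraph.dist_comm (u := y), h2.1, h2.2]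

theorem sum_branch_succ (hG : G.IsTree) (f : V → ℝ) (r : ℕ) (v w : V) :
    ∑ y ∈ branch G (r + 1) v w, f y =
      ∑ u ∈ (G.neighborFinset w).erase v, ∑ y ∈ branch G r w u, f y :=
  Finset.sum_biUnion (pairwiseDisjoint_branch hG r w (Finset.erase_subset _ _))

theorem sum_sphere_succ (hG : G.IsTree) (f : V → ℝ) (r : ℕ) (v : V) :
    ∑ y ∈ sphere G (r + 1) v, f y = ∑ w ∈ G.neighborFinset v, ∑ y ∈ branch G r v w, f y :=
  Finset.sum_biUnion (pairwiseDisjoint_branch hG r v subset_rfl)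

/-- The sphere about `v`, cut along the bond `(v, w)`. -/
theorem sum_sphere_eq_add (hG : G.IsTree) (f : V → ℝ) (r : ℕ) {v w : V} (h : G.Adj v w) :
    ∑ y ∈ sphere G (r + 1) v, f y =
      ∑ y ∈ branch G r v w, f y + ∑ y ∈ branch G (r + 1) w v, f y := by
  rw [← Finset.sum_union]
  · refine Finset.sum_congr ?_ fun _ _ => rfl
    ext y
    rw [Finset.mem_union, mem_sphere hG, mem_branch hG h, mem_branch hG h.symm]
    have := hG.dist_eq_dist_add_one_of_adj y h
    rw [SimpleGraph.dist_comm, SimpleGraph.dist_comm (u := y)] at this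
    omega
  · rw [Finset.disjoint_left]
    intro y h1 h2
    rw [mem_branch hG h] at h1
    rw [mem_branch hG h.symm] at h2
    omega

theorem card_erase_neighborFinset (hd : G.IsRegularOfDegree 3) {v w : V} (h : G.Adj v w) :
    ((G.neighborFinset w).erase v).card = 2 := by
  rw [Finset.card_erase_of_mem (by simpa using h.symm), G.card_neighborFinset_eq_degree, hd w]

theorem card_branch (hG : G.IsTree) (hd : G.IsRegularOfDegree 3) (r : ℕ) {v w : V}
    (h : G.Adj v w) : (branch G r v w).card = 2 ^ r := by
  induction r generalizing v w with
  | zero => rfl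
  | succ r ih =>
    rw [branch, Finset.card_biUnion (pairwiseDisjoint_branch hG r w (Finset.erase_subset _ _)),
      Finset.sum_congr rfl fun u hu => ih (by simpa using Finset.mem_of_mem_erase hu),
      Finset.sum_const, card_erase_neighborFinset hd h, smul_eq_mul, pow_succ, mul_comm]

theorem card_sphere_succ (hG : G.IsTree) (hd : G.IsRegularOfDegree 3) (r : ℕ) (v : V) :
    (sphere G (r + 1) v).card = 3 * 2 ^ r := by
  rw [sphere, Finset.card_biUnion (pairwiseDisjoint_branch hG r v subset_rfl),
    Finset.sum_congr rfl fun u hu => card_branch hG hd r (by simpa using hu), Finset.sum_const,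
    G.card_neighborFinset_eq_degree, hd v, smul_eq_mul]

/-- If the averages over the branches away from the root converge, so do those over the spheres
about any vertex. -/
theorem tendsto_sphere (hG : G.IsTree) (hd : G.IsRegularOfDegree 3) (o : V) {f : V → ℝ} {m : ℝ}
    (hf : ∀ w, w ≠ o →
      Tendsto (fun r => (∑ y ∈ branch G r (parent G o w) w, f y) / 2 ^ r) atTop (𝓝 m)) (v : V) :
    Tendsto (fun r => (∑ y ∈ sphere G (r + 1) v, f y) / 2 ^ r) atTop (𝓝 (3 * m)) := by
  induction hr : G.dist o v generalizing v with
  | zero =>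
    obtain rfl := hG.connected.dist_eq_zero_iff.1 hr
    have h1 : ∀ w ∈ G.neighborFinset o,
        Tendsto (fun r => (∑ y ∈ branch G r o w, f y) / 2 ^ r) atTop (𝓝 m) := by
      intro w hw
      rw [SimpleGraph.mem_neighborFinset] at hw
      have h2 : o = parent G o w :=
        eq_parent hG hw.symm (by simp [SimpleGraph.dist_eq_one_iff_adj.2 hw])
      have h3 := hf w hw.ne'
      rwa [← h2] at h3
    have h2 := tendsto_finsetSum _ h1
    rw [Finset.sum_const, G.card_neighborFinset_eq_degree, hd o, nsmul_eq_mul] at h2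
    refine h2.congr fun r => ?_
    rw [sum_sphere_succ hG, Finset.sum_div]
  | succ d ih =>
    have hv := ne_root_of_dist hr
    have hadj := parent_adj hG hv
    have hdist := dist_parent hG hv
    have h1 := ih (parent G o v) (by omega)
    have h2 := hf v hv
    -- The branch towards the root is the sphere about the parent minus the branch at `v`; at depth
    -- `r + 1` this is asymptotically `(3m - m) 2 ^ r = m 2 ^ (r + 1)`.
    have h3 : Tendsto (fun r => (∑ y ∈ branch G r v (parent G o v), f y) / 2 ^ r) atTop (𝓝 m) := by
      rw [← tendsto_add_atTop_iff_nat 1]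
      have h4 := (h1.sub h2).div_const 2
      have h5 : (3 * m - m) / 2 = m := by ring
      rw [h5] at h4
      refine h4.congr fun r => ?_
      rw [sum_sphere_eq_add hG f r hadj.symm, pow_succ]
      field_simp
      ring
    have h4 := h3.add (((tendsto_add_atTop_iff_nat 1).2 h2).const_mul 2)
    have h5 : m + 2 * m = 3 * m := by ring
    rw [h5] at h4
    refine h4.congr fun r => ?_
    rw [sum_sphere_eq_add hG f r hadj, pow_succ]
    field_simp

theorem hasMeanMagnetization_of_tendsto (hG : G.IsTree) (hd : G.IsRegularOfDegree 3) (o : V)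
    {σ : V → Spin} {m : ℝ} (hσ : ∀ w, w ≠ o → Tendsto
      (fun r => (∑ y ∈ branch G r (parent G o w) w, spinVal (σ y)) / 2 ^ r) atTop (𝓝 m)) :
    HasMeanMagnetization G σ m := by
  intro v
  let g : ℕ → ℝ := fun j => (sphere G j v).card
  let h : ℕ → ℝ := fun j => ∑ y ∈ sphere G j v, spinVal (σ y)
  have hg : ∀ j, 1 ≤ g j := by
    intro j
    cases j with
    | zero => simp [g, sphere]
    | succ j =>
      simp only [g, card_sphere_succ hG hd]
      push_cast
      have := one_le_pow₀ (one_le_two : (1 : ℝ) ≤ 2) (n := j)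
      linarith
  have hball : ∀ r, {x : V | G.dist v x ≤ r} =
      (((Finset.range (r + 1)).biUnion fun j => sphere G j v : Finset V) : Set V) := by
    intro r
    ext x
    simp only [Finset.coe_biUnion, Set.mem_iUnion, Finset.mem_coe, mem_sphere hG,
      Finset.mem_range, exists_prop]
    exact ⟨fun h => ⟨_, Nat.lt_succ_of_le h, rfl⟩, fun ⟨j, hj, h⟩ => h.trans_le (Nat.le_of_lt_succ hj)⟩
  have hdisj : ∀ r, ((Finset.range (r + 1) : Finset ℕ) : Set ℕ).PairwiseDisjoint
      fun j => sphere G j v := by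
    intro r i _ j _ hij
    rw [Function.onFun, Finset.disjoint_left]
    intro y h1 h2
    rw [mem_sphere hG] at h1 h2
    exact hij (h1.symm.trans h2)
  -- A weighted Cesàro argument: the sphere sums are asymptotic to `m` times the sphere sizes, whose
  -- partial sums diverge, so the same holds for balls.
  have hlim : (fun j => h j - m * g j) =o[atTop] g := by
    rw [Asymptotics.isLittleO_iff_tendsto' (Eventually.of_forall fun j h0 => by
      have := hg j
      linarith), ← tendsto_add_atTop_iff_nat 1]
    have h1 := ((tendsto_sphere hG hd o hσ v).div_const 3).sub_const m
    have h2 : 3 * m / 3 - m = 0 := by ring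
    rw [h2] at h1
    refine h1.congr fun r => ?_
    simp only [g, h, card_sphere_succ hG hd]
    push_cast
    field_simp
  have hsum : Tendsto (fun n => ∑ j ∈ Finset.range n, g j) atTop atTop := by
    refine tendsto_atTop_mono (fun n => ?_) tendsto_natCast_atTop_atTop
    have h1 := Finset.sum_le_sum fun j (_ : j ∈ Finset.range n) => hg j
    simpa using h1
  have hlim2 := (hlim.sum_range (fun j => zero_le_one.trans (hg j)) hsum).tendsto_div_nhds_zero
  have hlim3 := ((tendsto_add_atTop_iff_nat 1).2 hlim2).add_const m
  rw [zero_add] at hlim3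
  refine hlim3.congr fun r => ?_
  have hpos : 0 < ∑ j ∈ Finset.range (r + 1), g j :=
    Finset.sum_pos (fun j _ => zero_lt_one.trans_le (hg j)) ⟨0, by simp⟩
  rw [hball, finsum_mem_coe_finset, Finset.sum_biUnion (hdisj r), Set.ncard_coe_finset,
    Finset.card_biUnion (hdisj r)]
  push_cast
  change _ = (∑ j ∈ Finset.range (r + 1), h j) / ∑ j ∈ Finset.range (r + 1), g j
  rw [Finset.sum_sub_distrib, ← Finset.mul_sum]
  field_simp
  ring

end Branches

/-! ### Self-consistent configurations -/

section SelfConsistent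

variable {G : SimpleGraph V} {k : ℕ} {R : Set (Fin (k + 1) → V)} {o : V}

theorem IsRootedCovering.exists_selfConsistent (hG : G.IsTree) (hR : IsRootedCovering G o R)
    (l n : ℕ) : ∃ σ : V → Spin, IsDimerConfig G (splitDimers R l n σ) σ := by
  refine exists_isDimerConfig hG o (fun σ => splitDimers R l n σ) fun σ τ x hx hστ h => ?_
  obtain ⟨c, hc, j, hj, he⟩ := h
  refine ⟨c, hc, j, ?_, he⟩
  have h1 := hR.away c hc j.succ
  -- The dimer's position depends on `σ` only through the first vertex of its chain, which lies
  -- strictly closer to the root than `x`.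
  have h2 : G.dist o (c j.succ) ≤ G.dist o x := by
    have h3 := dist_parent hG hx
    rcases Sym2.eq_iff.1 he with ⟨-, h4⟩ | ⟨h4, -⟩
    · rw [h4]
    · rw [← h4]
      omega
  rw [Fin.val_succ] at h1
  rw [← hστ (c 0) (by omega)]
  exact hj

/-- The number of sites of a chain with first spin `s` before the spins change. -/
def splitLength (l n : ℕ) (s : Spin) : ℕ :=
  if s = 1 then l else n

theorem eq_neg_of_mul_eq_neg_one_spin {s t : Spin} (h : s * t = -1) : t = -s := by
  rw [← one_mul t, ← Int.units_mul_self s, mul_assoc, h, mul_neg_one]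

theorem eq_of_mul_eq_one_spin {s t : Spin} (h : s * t = 1) : t = s := by
  rw [← one_mul t, ← Int.units_mul_self s, mul_assoc, h, mul_one]

theorem IsCovering.chainBond_mem_splitDimers (hR : IsCovering G R) {l n : ℕ} {ρ : V → Spin}
    {c : Fin (k + 1) → V} (hc : c ∈ R) (j : Fin k) :
    chainBond c j ∈ splitDimers R l n ρ ↔ (j : ℕ) + 1 = splitLength l n (ρ (c 0)) := by
  constructor
  · rintro ⟨c', hc', j', hj', he⟩
    rcases Sym2.eq_iff.1 he with ⟨h1, -⟩ | ⟨h1, h2⟩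
    · obtain ⟨rfl, h2⟩ := hR.eq_of_apply_eq hc hc' h1
      rw [Fin.castSucc_inj.1 h2]
      exact hj'
    · obtain ⟨rfl, h3⟩ := hR.eq_of_apply_eq hc hc' h1
      obtain ⟨-, h4⟩ := hR.eq_of_apply_eq hc hc' h2
      have h5 := congrArg Fin.val h3
      have h6 := congrArg Fin.val h4
      simp only [Fin.val_succ, Fin.val_castSucc] at h5 h6
      omega
  · intro h
    exact ⟨c, hc, j, h, rfl⟩

theorem IsCovering.spin_eq_chainSpin (hR : IsCovering G R) {l n : ℕ} (hl : 0 < l) (hn : 0 < n)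
    {σ : V → Spin} (hσ : IsDimerConfig G (splitDimers R l n σ) σ) {c : Fin (k + 1) → V}
    (hc : c ∈ R) (i : Fin (k + 1)) :
    σ (c i) = chainSpin (splitLength l n) (σ (c 0)) i := by
  induction i using Fin.induction with
  | zero =>
    rw [chainSpin, Fin.val_zero, if_pos]
    unfold splitLength
    split_ifs <;> assumption
  | succ j ih =>
    have h1 := hσ _ _ ((hR.chain c hc).adj j)
    have h2 := hR.chainBond_mem_splitDimers (l := l) (n := n) (ρ := σ) hc j
    unfold chainSpin at *
    rw [Fin.val_castSucc] at ih
    rw [Fin.val_succ]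
    by_cases h3 : (j : ℕ) + 1 = splitLength l n (σ (c 0))
    · rw [eq_neg_of_mul_eq_neg_one_spin (h1.1 (h2.2 h3)), ih, if_pos (by omega), if_neg (by omega)]
    · rw [eq_of_mul_eq_one_spin (h1.2 fun h => h3 (h2.1 h)), ih]
      exact if_congr (by omega) rfl rfl

/-- A vertex other than the root either continues the chain of its parent, or it starts a chain and
has the spin of its parent. -/
theorem IsRootedCovering.continues_or_starts (hG : G.IsTree) (hR : IsRootedCovering G o R)
    {l n : ℕ} {ρ σ : V → Spin} (hσ : IsDimerConfig G (splitDimers R l n ρ) σ) {u : V}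
    (hu : u ≠ o) : (∃ c ∈ R, ∃ j : Fin k, u = c j.succ) ∨
      ∃ c ∈ R, u = c 0 ∧ σ u = σ (parent G o u) := by
  obtain ⟨c, ⟨hc, i, hi⟩, -⟩ := hR.existsUnique u
  rcases Fin.eq_zero_or_eq_succ i with rfl | ⟨j, rfl⟩
  · refine Or.inr ⟨c, hc, hi.symm, ?_⟩
    refine eq_of_mul_eq_one_spin ((hσ _ _ (parent_adj hG hu).symm).2 ?_)
    rintro ⟨c', hc', j, -, he⟩
    rcases Sym2.eq_iff.1 he with ⟨-, h2⟩ | ⟨h1, h2⟩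
    · obtain ⟨rfl, h3⟩ := hR.toIsCovering.eq_of_apply_eq hc hc' (hi.trans h2)
      exact absurd h3.symm (Fin.succ_ne_zero j)
    · have h3 := dist_parent hG hu
      have h4 := hR.away c hc
      have h5 := hR.away c' hc' j.succ
      have h6 := hR.away c' hc' j.castSucc
      rw [h1, h2] at h3
      simp only [Fin.val_succ, Fin.val_castSucc] at h5 h6
      omega
  · exact Or.inl ⟨c, hc, j, hi.symm⟩

/-- Ties the tree to the Markov chain. A vertex of index `i < k` has one child continuing its chain,
and its other child starts a new chain with the same spin, because bonds between chains are not
dimers. At `i = k` both children start new chains. -/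
theorem IsRootedCovering.sum_branch [DecidableEq V] [G.LocallyFinite] (hG : G.IsTree)
    (hd : G.IsRegularOfDegree 3) (hR : IsRootedCovering G o R) {l n : ℕ} (hl : 0 < l) (hn : 0 < n)
    {σ : V → Spin} (hσ : IsDimerConfig G (splitDimers R l n σ) σ) (r : ℕ)
    {c : Fin (k + 1) → V} (hc : c ∈ R) (i : Fin (k + 1)) (hi : c i ≠ o) :
    ∑ y ∈ branch G r (parent G o (c i)) (c i), spinVal (σ y) =
      2 ^ r * meanSpin k (splitLength l n) r (σ (c 0)) i := by
  induction r generalizing c i with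
  | zero =>
    rw [branch, Finset.sum_singleton, meanSpin, pow_zero, one_mul,
      hR.toIsCovering.spin_eq_chainSpin hl hn hσ hc]
  | succ r ih =>
    have hchild : ∀ u ∈ (G.neighborFinset (c i)).erase (parent G o (c i)),
        u ≠ o ∧ parent G o u = c i := by
      intro u hu
      rw [Finset.mem_erase, SimpleGraph.mem_neighborFinset] at hu
      rcases parent_cases hG o hu.2 with h | h
      · exact absurd h.2 hu.1
      · exact ⟨h.1, h.2.symm⟩
    have hcont : ∀ u ∈ (G.neighborFinset (c i)).erase (parent G o (c i)), ∀ c' ∈ R, ∀ j : Fin k,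
        u = c' j.succ → c' = c ∧ i = j.castSucc := by
      rintro u hu c' hc' j rfl
      have h1 := (hchild _ hu).2
      rw [(hR.parent_succ hG hc' j).2] at h1
      obtain ⟨h2, h3⟩ := hR.toIsCovering.eq_of_apply_eq hc' hc h1
      exact ⟨h2, h3.symm⟩
    have hnew : ∀ u ∈ (G.neighborFinset (c i)).erase (parent G o (c i)),
        (∀ c' ∈ R, ∀ j : Fin k, u ≠ c' j.succ) → ∑ y ∈ branch G r (c i) u, spinVal (σ y) =
          2 ^ r * meanSpin k (splitLength l n) r
            (chainSpin (splitLength l n) (σ (c 0)) i) 0 := by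
      intro u hu hne
      rcases hR.continues_or_starts hG hσ (hchild u hu).1 with ⟨c', hc', j, h⟩ | ⟨c', hc', h, hs⟩
      · exact absurd h (hne c' hc' j)
      · have h1 := ih hc' 0 (h ▸ (hchild u hu).1)
        rw [← h, hs, (hchild u hu).2, hR.toIsCovering.spin_eq_chainSpin hl hn hσ hc i] at h1
        exact h1
    have hcard := card_erase_neighborFinset hd (parent_adj hG hi).symm
    rw [sum_branch_succ hG, meanSpin]
    rcases Fin.eq_castSucc_or_eq_last i with ⟨j, rfl⟩ | rfl
    · have hmem : c j.succ ∈ (G.neighborFinset (c j.castSucc)).erase (parent G o (c j.castSucc)) := by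
        have h1 := hR.parent_succ hG hc j
        rw [Finset.mem_erase, SimpleGraph.mem_neighborFinset]
        refine ⟨fun h => ?_, (hR.chain c hc).adj j⟩
        have h2 := dist_parent hG hi
        have h3 := dist_parent hG h1.1
        rw [h1.2] at h3
        rw [← h] at h2
        omega
      have h1 := ih hc j.succ (hR.parent_succ hG hc j).1
      rw [(hR.parent_succ hG hc j).2] at h1
      rw [← Finset.add_sum_erase _ _ hmem, h1, if_pos (by simp),
        Finset.sum_congr rfl fun u hu => hnew u (Finset.mem_of_mem_erase hu) ?_, Finset.sum_const,
        Finset.card_erase_of_mem hmem, hcard]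
      · simp only [Fin.val_succ, Fin.val_castSucc, Nat.add_one_sub_one, one_smul]
        ring
      · rintro c' hc' j' h
        obtain ⟨rfl, h2⟩ := hcont u (Finset.mem_of_mem_erase hu) c' hc' j' h
        rw [← Fin.castSucc_inj.1 h2] at h
        exact Finset.ne_of_mem_erase hu h
    · rw [if_neg (by simp), Finset.sum_congr rfl fun u hu => hnew u hu ?_, Finset.sum_const, hcard]
      · rw [pow_succ, nsmul_eq_mul]
        push_cast
        ring
      · intro c' hc' j h
        exact absurd (hcont u hu c' hc' j h).2.symm (Fin.castSucc_lt_last j).ne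

theorem IsRootedCovering.exists_hasMeanMagnetization [DecidableEq V] [G.LocallyFinite]
    (hG : G.IsTree) (hd : G.IsRegularOfDegree 3) (hR : IsRootedCovering G o R) {l n : ℕ}
    (hn : 0 < n) (hnl : n < l) (hk : k + 1 = l + n) {σ : V → Spin}
    (hσ : IsDimerConfig G (splitDimers R l n σ) σ) :
    ∃ M : ℝ, M ≠ 0 ∧ HasMeanMagnetization G σ M := by
  have hL1 : splitLength l n 1 = l := if_pos rfl
  have hL2 : splitLength l n (-1) = n := if_neg (by decide)
  obtain ⟨m, hm, hlim⟩ := exists_tendsto_meanSpin (k := k) (L := splitLength l n)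
    (by omega) (by omega)
  refine ⟨m, hm, hasMeanMagnetization_of_tendsto hG hd o fun w hw => ?_⟩
  obtain ⟨c, ⟨hc, i, rfl⟩, -⟩ := hR.existsUnique w
  refine (hlim (σ (c 0)) i (Nat.lt_succ_iff.1 i.2)).congr fun r => ?_
  rw [hR.sum_branch hG hd (hn.trans hnl) hn hσ r hc i hw, mul_div_cancel_left₀ _ (by positivity)]

end SelfConsistent

end CayleyIsing

open CayleyIsing in
theorem mainTheorem4 {V : Type*} [Countable V] [DecidableEq V]
    (G : SimpleGraph V) [G.LocallyFinite] (hG : G.IsTree) :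
    -- the tree `𝒯₂`: every vertex has three neighbours
    (G.IsRegularOfDegree 3 →
      -- rooted coverings exist, for every root and every length of the chains
      (∀ (o : V) (k : ℕ), ∃ R : Set (Fin (k + 1) → V), IsRootedCovering G o R) ∧
      -- middle dimers, `k = 2m + 1 ≥ 5`
      (∀ (k m : ℕ), k = 2 * m + 1 → 5 ≤ k →
        ∀ (o : V) (R : Set (Fin (k + 1) → V)), IsRootedCovering G o R →
          (∃ σ : V → Spin, IsDimerConfig G (middleDimers R) σ) ∧
          ∀ σ : V → Spin, IsDimerConfig G (middleDimers R) σ →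
            IsGroundState G σ ∧ IsStable G σ) ∧
      -- for `k = 1` the claim fails on this tree
      (∀ R : Set (Fin (1 + 1) → V), IsCovering G R →
        ∀ σ : V → Spin, IsDimerConfig G (middleDimers R) σ →
          ¬ IsGroundState G σ ∧ ¬ IsStable G σ) ∧
      -- the collections `D_{l:n}`
      (∃ n₀ : ℕ, ∀ (l n k : ℕ), n₀ ≤ n → 0 < n → n < l → k + 1 = l + n →
        ∀ (o : V) (R : Set (Fin (k + 1) → V)), IsRootedCovering G o R →
          (∀ ρ : V → Spin,
            (∃ σ : V → Spin, IsDimerConfig G (splitDimers R l n ρ) σ) ∧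
            ∀ σ : V → Spin, IsDimerConfig G (splitDimers R l n ρ) σ →
              IsGroundState G σ ∧ IsStable G σ) ∧
          (∃ σ : V → Spin, IsDimerConfig G (splitDimers R l n σ) σ) ∧
          (∀ σ : V → Spin, IsDimerConfig G (splitDimers R l n σ) σ →
            ∃ M : ℝ, M ≠ 0 ∧ HasMeanMagnetization G σ M))) ∧
    -- the trees `𝒯_N`, `N ≥ 4`: arbitrary coverings, all odd `k ≥ 1`
    (∀ N : ℕ, 4 ≤ N → G.IsRegularOfDegree (N + 1) →
      ∀ (k m : ℕ), k = 2 * m + 1 →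
        ∀ R : Set (Fin (k + 1) → V), IsCovering G R →
          (∃ σ : V → Spin, IsDimerConfig G (middleDimers R) σ) ∧
          ∀ σ : V → Spin, IsDimerConfig G (middleDimers R) σ →
            IsGroundState G σ ∧ IsStable G σ) := by
  -- With `n₀ = 3` both possible dimer indices `l - 1` and `n - 1` are at least `2`, as
  -- `IsRootedCovering.card_dimers_le` requires; for middle dimers the same follows from `k ≥ 5`.
  refine ⟨fun hd => ⟨fun o k => ?_, ?_, ?_, 3, ?_⟩, ?_⟩
  · exact exists_isRootedCovering hG (fun x => by rw [hd x]; norm_num) o k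
  · intro k m hk hk5 o R hR
    refine ⟨exists_isDimerConfig_const hG _, fun σ hσ => ?_⟩
    rw [middleDimers_eq_dimers hk] at hσ
    have hstable : IsStable G σ := (hR.peierlsCondition hG hd
      (fun _ => by simp only; omega) hσ).isStable hd (by norm_num)
    exact ⟨hstable.isGroundState, hstable⟩
  · intro R hR σ hσ
    rw [middleDimers_eq_dimers (m := 0) rfl] at hσ
    have hground := hR.not_isGroundState hG hd hσ
    exact ⟨hground, fun h => hground h.isGroundState⟩
  · intro l n k hn0 hn hnl hk o R hR
    refine ⟨fun ρ => ⟨exists_isDimerConfig_const hG _, fun σ hσ => ?_⟩,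
      hR.exists_selfConsistent hG l n,
      fun σ hσ => hR.exists_hasMeanMagnetization hG hd hn hnl hk hσ⟩
    rw [splitDimers_eq_dimers (by omega) hn (by omega) (by omega)] at hσ
    have hstable : IsStable G σ := (hR.peierlsCondition hG hd (fun c => by
      unfold splitIndex
      split_ifs <;> simp only <;> omega) hσ).isStable hd (by norm_num)
    exact ⟨hstable.isGroundState, hstable⟩
  · intro N hN hd k m hk R hR
    refine ⟨exists_isDimerConfig_const hG _, fun σ hσ => ?_⟩
    rw [middleDimers_eq_dimers hk] at hσ
    have hstable : IsStable G σ := (hR.peierlsCondition hG hN hd hσ).isStable hd one_pos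
    exact ⟨hstable.isGroundState, hstable⟩
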